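/- Let $k$ be a field, let $V=\operatorname{Spec} R$ be an irreducible affine variety over $k$, i.e. $R$ is a finitely generated $k$-algebra without zero divisors, and let $K$ be the fraction field of $R$. Let $L\subset \operatorname{Der}_k(K,K)$ be a singular foliation, i.e. a $K$-linear subspace closed under the Lie bracket, with $K$-basis $\delta_1,\dots,\delta_r$. For an ideal $I\subset R$ let $\mathcal J(I)\subset K$ be the fractional ideal of $R$ generated by the determinants of all $(r+1)\times(r+1)$ matrices with rows $(f_i,\delta_1 f_i,\dots,\delta_r f_i)$, $i=0,\dots,r$, for $f_0,\dots,f_r\in I$. Let $\mathrm{Bl}_I(V)$ be the blowup of $V$ along $I$; its function field is identified with $K$ (if $I=0$ it is empty). One says that $L$ lifts to a nonsingular foliation on $\mathrm{Bl}_I(V)$ if for every nonempty affine open $U\subset \mathrm{Bl}_I(V)$, with coordinate ring $A\subset K$, the image of the $A$-linear map $\Omega_{A/k}\to \operatorname{Hom}_K(L,K)$, $dx\mapsto(\delta\mapsto\delta(x))$, is a projective $A$-module. Then an ideal $I\subset R$ has the property that $L$ lifts to a nonsingular foliation on $\mathrm{Bl}_I(V)$ if and only if $\mathcal J(I)$ is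 a divisor of a power of $I$ as a fractional ideal, i.e. if and only if there are a fractional ideal $S$ of $R$ and a natural number $\alpha\ge 0$ such that $$S\,\mathcal J(I)=I^{\alpha}.$$ -/

import Mathlib

open CategoryTheory AlgebraicGeometry
open scoped nonZeroDivisors Polynomial DirectSum

universe u v

/-! ## Singular foliations and reduced differentials -/

/-- A singular foliation on (any model of) the function field `K` over `k`: a `K`-linear subspace
of `Der_k(K, K)` that is closed under the Lie bracket. -/
structure SingularFoliation (k : Type v) (K : Type u) [Field k] [Field K] [Algebra k K]
    extends Submodule K (Derivation k K K) where
  lie_mem' : ∀ {D E : Derivation k K K}, D ∈ carrier → E ∈ carrier → ⁅D, E⁆ ∈ carrier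

section Differentials

variable {k : Type v} {K : Type u} [Field k] [Field K] [Algebra k K]

/-- The `K`-linear dual `Hom_K(L, K)` of a foliation. -/
abbrev SingularFoliation.Dual (L : SingularFoliation k K) : Type u :=
  Module.Dual K L.toSubmodule

/-- The derivation `A → Hom_K(L, K)`, `x ↦ (δ ↦ δ x)`, for a subalgebra `A` of `K`. -/
def SingularFoliation.dBar (L : SingularFoliation k K) (A : Subalgebra k K) :
    Derivation k A L.Dual where
  toFun x :=
    { toFun := fun δ => (δ : Derivation k K K) (x : K)
      map_add' := fun _ _ => rfl
      map_smul' := fun _ _ => rfl }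
  map_add' x y := by ext δ; exact map_add (δ : Derivation k K K) (x : K) y
  map_smul' c x := by ext δ; exact (δ : Derivation k K K).map_smul c (x : K)
  map_one_eq_zero' := by ext δ; exact (δ : Derivation k K K).map_one_eq_zero
  leibniz' x y := by ext δ; exact (δ : Derivation k K K).leibniz (x : K) (y : K)

/-- The reduced differentials of `A ⊆ K` along `L`: the image of the `A`-linear map
`Ω_{A/k} → Hom_K(L, K)`, `dx ↦ (δ ↦ δ x)`. -/
noncomputable def SingularFoliation.reducedDifferentials (L : SingularFoliation k K)
    (A : Subalgebra k K) : Submodule A L.Dual :=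
  LinearMap.range (L.dBar A).liftKaehlerDifferential

end Differentials

/-! ## Foliations on birational models -/

section Models

variable {R K : Type u} [CommRing R] [Field K] [Algebra R K]

/-- For a scheme `X` over `R` with a `K`-valued point `ι` lying over the `K`-valued point of
`Spec R` (in the application: the generic point of a variety `X` with function field `K`), the
`R`-subalgebra of `K` of the elements that are sections of `X` over the open set `U`. -/
noncomputable def sectionSubalgebra {X : Scheme.{u}} (π : X ⟶ Spec (.of R))
    (ι : Spec (.of K) ⟶ X) (h : ι ≫ π = Spec.map (CommRingCat.ofHom (algebraMap R K)))
    (U : X.Opens) : Subalgebra R K where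
  __ := ((ι.app U).hom.range).comap
    ((Scheme.ΓSpecIso (.of K)).inv ≫
      (Spec (.of K)).presheaf.map (homOfLE (le_top : ι ⁻¹ᵁ U ≤ ⊤)).op).hom
  algebraMap_mem' r := by
    refine ⟨X.presheaf.map (homOfLE (le_top : U ≤ ⊤)).op
      (π.appTop ((Scheme.ΓSpecIso (.of R)).inv r)), ?_⟩
    have h1 := ConcreteCategory.congr_hom
      (Scheme.ΓSpecIso_inv_naturality (CommRingCat.ofHom (algebraMap R K))) r
    rw [← h] at h1
    simp only [CommRingCat.hom_comp, RingHom.comp_apply, Scheme.Hom.comp_appTop,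
      CommRingCat.hom_ofHom] at h1 ⊢
    have h2 := ConcreteCategory.congr_hom (ι.naturality (homOfLE (le_top : U ≤ ⊤)).op)
      (π.appTop ((Scheme.ΓSpecIso (.of R)).inv r))
    exact h2.trans (congrArg ((Spec (.of K)).presheaf.map
      (homOfLE (le_top : ι ⁻¹ᵁ U ≤ ⊤)).op).hom h1.symm)

end Models

/-! ## Blowing up -/

section Blowup

variable {R : Type u} [CommRing R] (I : Ideal R)

/-- The degree `n` part `Iⁿ tⁿ` of the Rees algebra `R[It] = ⨁ Iⁿ tⁿ ⊆ R[t]`. -/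
noncomputable def reesGrading (n : ℕ) : Submodule R (reesAlgebra I) :=
  (LinearMap.range (Polynomial.monomial (R := R) n)).comap (reesAlgebra I).val.toLinearMap

theorem mem_reesGrading {n : ℕ} {p : reesAlgebra I} :
    p ∈ reesGrading I n ↔ ∃ a : R, Polynomial.monomial n a = (p : R[X]) := Iff.rfl

instance reesGrading.gradedMonoid : SetLike.GradedMonoid (reesGrading I) where
  one_mem := ⟨1, rfl⟩
  mul_mem := by
    rintro i j p q ⟨a, ha⟩ ⟨b, hb⟩
    refine ⟨a * b, ?_⟩
    rw [← Polynomial.monomial_mul_monomial, ha, hb]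
    rfl

theorem reesGrading.coeff_coe (x : ⨁ n, reesGrading I n) (n : ℕ) :
    ((DirectSum.coeAddMonoidHom (reesGrading I) x : reesAlgebra I) : R[X]).coeff n =
      ((x n : reesAlgebra I) : R[X]).coeff n := by
  induction x using DirectSum.induction_on with
  | zero => simp
  | of i y =>
    obtain ⟨y, a, ha⟩ := y
    rw [DirectSum.coeAddMonoidHom_of, DirectSum.coe_of_apply]
    split_ifs with hi
    · rfl
    · change (y : R[X]).coeff n = (0 : R[X]).coeff n
      change Polynomial.monomial i a = (y : R[X]) at ha
      rw [← ha, Polynomial.coeff_zero]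
      exact Polynomial.coeff_monomial_of_ne a (Ne.symm hi)
  | add x y hx hy =>
    rw [map_add, DirectSum.add_apply]
    change (_ + _ : R[X]).coeff n = (_ + _ : R[X]).coeff n
    rw [Polynomial.coeff_add, Polynomial.coeff_add]
    exact congrArg₂ _ hx hy

noncomputable instance reesGrading.gradedAlgebra : GradedAlgebra (reesGrading I) where
  toDecomposition := by
    refine DirectSum.IsInternal.chooseDecomposition _ ⟨fun x y hxy => ?_, fun p => ?_⟩
    · refine DFinsupp.ext fun n => Subtype.ext (Subtype.ext ?_)
      have h : ((x n : reesAlgebra I) : R[X]).coeff n = ((y n : reesAlgebra I) : R[X]).coeff n := by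
        rw [← coeff_coe, ← coeff_coe, hxy]
      obtain ⟨a, ha⟩ := (x n).2
      obtain ⟨b, hb⟩ := (y n).2
      change Polynomial.monomial n a = ((x n : reesAlgebra I) : R[X]) at ha
      change Polynomial.monomial n b = ((y n : reesAlgebra I) : R[X]) at hb
      rw [← ha, ← hb, Polynomial.coeff_monomial_same, Polynomial.coeff_monomial_same] at h
      rw [← ha, ← hb, h]
    · refine ⟨∑ n ∈ (p : R[X]).support, DirectSum.of (fun n => reesGrading I n) n
        ⟨⟨Polynomial.monomial n ((p : R[X]).coeff n),
          reesAlgebra.monomial_mem.mpr (p.2 n)⟩, _, rfl⟩, Subtype.ext ?_⟩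
      rw [map_sum]
      simp only [DirectSum.coeAddMonoidHom_of]
      rw [AddSubmonoidClass.coe_finsetSum]
      exact ((p : R[X]).as_sum_support).symm

/-- The blowup `Bl_I(V)` of `V = Spec R` along the ideal `I`, i.e. `Proj` of the Rees algebra. -/
noncomputable abbrev blowup : Scheme.{u} := Proj (reesGrading I)

/-- The structure map of the blowup. -/
noncomputable def blowupMap : blowup I ⟶ Spec (.of R) :=
  Proj.toSpecZero (reesGrading I) ≫
    Spec.map (CommRingCat.ofHom (algebraMap R (reesGrading I 0)))

/-- For a nonzero ideal of a domain with fraction field `K`, the blowup has a `K`-valued point over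
the generic point of `Spec R` (it is the generic point of the blowup, and it is unique). -/
theorem exists_blowup_genericPoint (K : Type u) [Field K] [Algebra R K] [FaithfulSMul R K]
    (hI : I ≠ ⊥) : ∃ ι : Spec (.of K) ⟶ blowup I,
      ι ≫ blowupMap I = Spec.map (CommRingCat.ofHom (algebraMap R K)) := by
  obtain ⟨f, hf, hf0⟩ := Submodule.exists_mem_ne_zero_of_ne_bot hI
  let t : reesAlgebra I := ⟨Polynomial.monomial 1 f, reesAlgebra.monomial_mem.mpr (by simpa)⟩
  have ht : t ∈ reesGrading I 1 := ⟨f, rfl⟩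
  let φ : reesAlgebra I →+* K :=
    (Polynomial.aeval (1 : K)).toRingHom.comp (reesAlgebra I).val.toRingHom
  have hφt : φ t = algebraMap R K f := by
    change Polynomial.aeval (1 : K) (Polynomial.monomial 1 f) = _
    simp [Polynomial.aeval_monomial]
  have hu : IsUnit (φ t) := by
    rw [hφt]
    exact (by simpa using hf0 : algebraMap R K f ≠ 0).isUnit
  let ψ : HomogeneousLocalization.Away (reesGrading I) t →+* K :=
    (IsLocalization.Away.lift t hu : Localization.Away t →+* K).comp (algebraMap _ _)
  refine ⟨Spec.map (CommRingCat.ofHom ψ) ≫ Proj.awayι (reesGrading I) t ht one_pos, ?_⟩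
  rw [blowupMap, Category.assoc, Proj.awayι_toSpecZero_assoc, ← Spec.map_comp, ← Spec.map_comp]
  congr 1
  ext r
  change IsLocalization.Away.lift t hu (Localization.mk (algebraMap R (reesAlgebra I) r) 1) = _
  rw [Localization.mk_one_eq_algebraMap, IsLocalization.Away.lift_eq]
  change Polynomial.aeval (1 : K) (Polynomial.C r) = _
  simp

end Blowup

/-! ## Nonsingularity of the lifted foliation -/

section Lift

variable {k : Type v} {R K : Type u} [Field k] [CommRing R] [Field K]
  [Algebra k R] [Algebra R K] [Algebra k K] [IsScalarTower k R K]

/-- The foliation `L` is nonsingular on the variety `X` over `Spec R` with generic point `ι`: for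
each nonempty affine open `U`, with coordinate ring `A ⊆ K`, the image of
`Ω_{A/k} → Hom_K(L, K)` is a projective `A`-module. -/
def SingularFoliation.IsNonsingularOn (L : SingularFoliation k K) {X : Scheme.{u}}
    (π : X ⟶ Spec (.of R)) (ι : Spec (.of K) ⟶ X)
    (h : ι ≫ π = Spec.map (CommRingCat.ofHom (algebraMap R K))) : Prop :=
  ∀ U : X.Opens, IsAffineOpen U → (U : Set X).Nonempty →
    Module.Projective ((sectionSubalgebra π ι h U).restrictScalars k)
      (L.reducedDifferentials ((sectionSubalgebra π ι h U).restrictScalars k))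

/-- `L` lifts to a nonsingular foliation on `Bl_I(V)`, `V = Spec R`, whose function field is
identified with `K` through its generic point `ι`, the unique `K`-valued point over the generic
point of `V`. (For `I = 0` the blowup is empty and there is nothing to check.) -/
def SingularFoliation.LiftsToNonsingular (L : SingularFoliation k K) (I : Ideal R) : Prop :=
  ∀ (ι : Spec (.of K) ⟶ blowup I)
    (h : ι ≫ blowupMap I = Spec.map (CommRingCat.ofHom (algebraMap R K))),
    L.IsNonsingularOn (blowupMap I) ι h

end Lift

/-! ## The fractional ideal of a fractional ideal and a basis of the foliation -/

section Jacobian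

variable {k : Type v} {R K : Type u} [Field k] [CommRing R] [Field K]
  [Algebra k R] [Algebra R K] [Algebra k K] [IsScalarTower k R K]

/-- The matrix with rows `(f i, δ₁ (f i), …, δᵣ (f i))`, `i = 0, …, r`. -/
def jacobianMatrix {r : ℕ} (δ : Fin r → Derivation k K K) (f : Fin (r + 1) → K) :
    Matrix (Fin (r + 1)) (Fin (r + 1)) K :=
  Matrix.of fun i => Fin.cons (f i) fun l => δ l (f i)

theorem exists_denominator [Algebra.FiniteType k R] [IsFractionRing R K] {r : ℕ}
    (δ : Fin r → Derivation k K K) :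
    ∃ d ∈ R⁰, ∀ l (a : R), IsLocalization.IsInteger R (d • δ l (algebraMap R K a)) := by
  classical
  obtain ⟨s, hs⟩ := (Algebra.FiniteType.out : (⊤ : Subalgebra k R).FG)
  obtain ⟨d, hd⟩ := IsLocalization.exist_integer_multiples (M := R⁰) (S := K)
    (Finset.univ ×ˢ s : Finset (Fin r × R)) fun p => δ p.1 (algebraMap R K p.2)
  refine ⟨d, d.2, fun l a => ?_⟩
  have ha : a ∈ Algebra.adjoin k (s : Set R) := hs ▸ Algebra.mem_top
  induction ha using Algebra.adjoin_induction with
  | mem x hx => exact hd (l, x) (by simpa using hx)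
  | algebraMap c =>
    rw [← IsScalarTower.algebraMap_apply, Derivation.map_algebraMap, smul_zero]
    exact IsLocalization.isInteger_zero
  | add x y _ _ hx hy =>
    rw [map_add, map_add, smul_add]
    exact IsLocalization.isInteger_add hx hy
  | mul x y _ _ hx hy =>
    rw [map_mul, Derivation.leibniz, smul_add, algebraMap_smul, algebraMap_smul, smul_comm _ x,
      smul_comm _ y]
    exact IsLocalization.isInteger_add (IsLocalization.isInteger_smul hy)
      (IsLocalization.isInteger_smul hx)

theorem isFractional_jacobian [Algebra.FiniteType k R] [IsFractionRing R K] {r : ℕ}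
    (δ : Fin r → Derivation k K K) (I : FractionalIdeal R⁰ K) :
    IsFractional R⁰ (Submodule.span R
      {x : K | ∃ f : Fin (r + 1) → K, (∀ i, f i ∈ I) ∧ x = (jacobianMatrix δ f).det}) := by
  obtain ⟨d, hd, hδ⟩ := exists_denominator (R := R) δ
  obtain ⟨e, he, hI⟩ := I.isFractional
  rw [FractionalIdeal.isFractional_span_iff]
  refine ⟨(d * e ^ 2) ^ (r + 1), pow_mem (mul_mem hd (pow_mem he 2)) _, ?_⟩
  rintro _ ⟨f, hf, rfl⟩
  have key : ∀ i j, IsLocalization.IsInteger R ((d * e ^ 2) • jacobianMatrix δ f i j) := by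
    intro i j
    obtain ⟨a, ha⟩ := hI (f i) (hf i)
    rw [Algebra.smul_def] at ha
    refine Fin.cases ?_ (fun l => ?_) j
    · refine ⟨d * e * a, ?_⟩
      simp only [jacobianMatrix, Matrix.of_apply, Fin.cons_zero, Algebra.smul_def, map_mul, map_pow,
        ha]
      ring
    · obtain ⟨p, hp⟩ := hδ l a
      obtain ⟨q, hq⟩ := hδ l e
      refine ⟨e * p - q * a, ?_⟩
      have h1 : δ l (algebraMap R K a) = algebraMap R K e * δ l (f i)
          + f i * δ l (algebraMap R K e) := by
        rw [ha, Derivation.leibniz, smul_eq_mul, smul_eq_mul]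
      simp only [jacobianMatrix, Matrix.of_apply, Fin.cons_succ, Algebra.smul_def, map_mul, map_pow,
        map_sub, hp, hq, h1]
      rw [ha]
      ring
  choose N hN using key
  refine ⟨(Matrix.of N).det, ?_⟩
  rw [RingHom.map_det]
  have : (algebraMap R K).mapMatrix (Matrix.of N) = (d * e ^ 2) • jacobianMatrix δ f := by
    ext i j
    simpa using hN i j
  rw [this, ← algebraMap_smul K (d * e ^ 2), Matrix.det_smul, Fintype.card_fin,
    ← algebraMap_smul K ((d * e ^ 2) ^ (r + 1)), map_pow, smul_eq_mul]

/-- The fractional ideal `𝒥(I)` generated by the determinants of the matrices with rows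
`(f i, δ₁ (f i), …, δᵣ (f i))`, for all `f 0, …, f r ∈ I`. -/
noncomputable def jacobianIdeal [Algebra.FiniteType k R] [IsFractionRing R K] {r : ℕ}
    (δ : Fin r → Derivation k K K) (I : FractionalIdeal R⁰ K) : FractionalIdeal R⁰ K :=
  ⟨Submodule.span R
    {x : K | ∃ f : Fin (r + 1) → K, (∀ i, f i ∈ I) ∧ x = (jacobianMatrix δ f).det},
    isFractional_jacobian δ I⟩

end Jacobian

/-!
The blowup is covered by the charts `Spec R[I/f]` with `0 ≠ f ∈ I`, and on such a chart `I` becomes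
the principal ideal `(f)`. For a subalgebra `A` of `K` let `M_A` be its module of reduced
differentials, and let `Λ_A ⊆ K` be the `A`-module generated by the determinants `det (δ_l (a_i))`
with `a₁, …, aᵣ ∈ A`, that is, the image of the top exterior power of `M_A` in
`Λʳ Hom_K(L, K) ≅ K`. The proof rests on two facts.

* `M_A` is projective if `Λ_A` is an invertible `A`-submodule of `K`, and conversely if `A` is of
  finite type with fraction field `K`. If `1 = ∑ cᵢ det(nᵢ)` with `cᵢ Λ_A ⊆ A`, Cramer's rule
  exhibits a dual basis of `M_A` (`projective_of_one_mem_closure_detProducts`). Conversely, a dual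
  basis writes the identity of `Hom_K(L, K)` as `∑ φᵢ ⊗ mᵢ`, and the Cauchy-Binet formula for its
  determinant gives such an expression of `1` (`one_mem_closure_detProducts`).
* Over `A = R[I/f]` the ideal `𝒥(I)` generates `f ^ (r + 1) Λ_A` (`toSubmodule_mul_jacobianIdeal`):
  a Jacobian determinant is homogeneous of degree `r + 1` under multiplication of all functions by
  `f`, and at `1, t₁, …, tᵣ` it is `det (δ_l (t_i))`.

So `L` lifts to a nonsingular foliation on the chart exactly when `𝒥(I)` becomes invertible there.
If this holds on all charts, then `f ^ m ∈ 𝒥(I) (I ^ m : 𝒥(I))` for each `f ∈ I` and all large `m`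
(`exists_pow_mem_mul_div_of_projective`). Taking `f` in a finite set of generators of `I` gives
`I ^ α ⊆ 𝒥(I) (I ^ α : 𝒥(I))` for large `α`, so `S = (I ^ α : 𝒥(I))` is a cofactor. Conversely, if
`S 𝒥(I) = I ^ α`, then over any affine open set with coordinate ring `A`, not only over the charts,
`I ^ (r + 1) S (A : I ^ α)` is an inverse of `Λ_A`, because it is one locally
(`projective_of_forall_isMaximal_exists`). The last part of the argument identifies the algebras of
sections of the blowup with these subalgebras of `K`.
-/

/-! ### Projective lattices and their determinants -/

/-- The Cauchy-Binet formula, in the weak form that `det (X * Y)` is a sum of products of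
corresponding maximal minors of `X` and `Y`. The Leibniz expansion of the rows runs over all maps
`σ : m → n`; the maps that are not injective contribute zero, and those with a common image
differ by a permutation and add up to one product of minors. -/
theorem Matrix.det_mul_mem_closure_minors {R m n : Type*} [CommRing R] [Fintype m] [DecidableEq m]
    [Fintype n] [DecidableEq n] (X : Matrix m n R) (Y : Matrix n m R) :
    (X * Y).det ∈ AddSubmonoid.closure
      {z | ∃ σ : m → n, z = (X.submatrix id σ).det * (Y.submatrix σ id).det} := by
  classical
  let F : (m → n) → R := fun σ => (∏ i, X i (σ i)) * (Y.submatrix σ id).det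
  have hF : (X * Y).det = ∑ σ, F σ := by
    have h1 : (X * Y : Matrix m m R) = fun i => ∑ k, X i k • Y k := by
      ext i j
      simp [Matrix.mul_apply]
    have h2 := (Matrix.detRowAlternating (n := m) (R := R)).toMultilinearMap.map_sum
      (fun i k => X i k • Y k)
    calc (X * Y).det = Matrix.detRowAlternating (fun i => ∑ k, X i k • Y k) := by rw [← h1]; rfl
      _ = _ := h2
      _ = _ := Finset.sum_congr rfl fun σ _ =>
        (Matrix.detRowAlternating (n := m) (R := R)).toMultilinearMap.map_smul_univ
          (fun i => X i (σ i)) (fun i => Y (σ i))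
  have hF0 : ∀ σ : m → n, ¬ Function.Injective σ → F σ = 0 := by
    intro σ hσ
    obtain ⟨i, j, hij, hne⟩ : ∃ i j, σ i = σ j ∧ i ≠ j := by
      simpa [Function.Injective] using hσ
    simp only [F]
    rw [Matrix.det_zero_of_row_eq hne (by ext k; simp [hij]), mul_zero]
  rw [hF, ← Finset.sum_fiberwise Finset.univ (fun σ : m → n => Finset.univ.image σ)]
  refine sum_mem fun s _ => ?_
  by_cases hs : ∃ σ : m → n, Function.Injective σ ∧ Finset.univ.image σ = s
  · obtain ⟨σ, hσ, rfl⟩ := hs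
    refine AddSubmonoid.subset_closure ⟨σ, ?_⟩
    have hinj : Function.Injective fun τ : Equiv.Perm m => σ ∘ τ := fun τ₁ τ₂ h =>
      Equiv.ext fun i => hσ (congrFun h i)
    rw [← Finset.sum_subset (s₁ := Finset.univ.image fun τ : Equiv.Perm m => σ ∘ τ),
      Finset.sum_image hinj.injOn]
    · rw [← Matrix.det_transpose (X.submatrix id σ), Matrix.det_apply', Finset.sum_mul]
      refine Finset.sum_congr rfl fun τ _ => ?_
      have : Y.submatrix (σ ∘ τ) id = (Y.submatrix σ id).submatrix τ id := rfl
      simp only [F, this, Matrix.det_permute, Matrix.transpose_apply, Matrix.submatrix_apply, id,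
        Function.comp_apply]
      ring
    · intro ρ hρ
      obtain ⟨τ, -, rfl⟩ := Finset.mem_image.1 hρ
      refine Finset.mem_filter.2 ⟨Finset.mem_univ _, ?_⟩
      ext k
      simp only [Finset.mem_image, Finset.mem_univ, true_and, Function.comp_apply]
      exact ⟨fun ⟨i, hi⟩ => ⟨_, hi⟩, fun ⟨i, hi⟩ => ⟨τ.symm i, by simpa using hi⟩⟩
    · intro ρ hρ hρ'
      refine hF0 ρ fun hinjρ => hρ' ?_
      have hρs := (Finset.mem_filter.1 hρ).2
      have : ∀ i, ∃ j, σ j = ρ i := fun i => by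
        have : ρ i ∈ Finset.univ.image σ := hρs ▸ Finset.mem_image_of_mem ρ (Finset.mem_univ i)
        simpa using this
      choose τ hτ using this
      have hτi : Function.Injective τ := fun i j h => hinjρ (by rw [← hτ, ← hτ, h])
      refine Finset.mem_image.2 ⟨Equiv.ofBijective τ (Finite.injective_iff_bijective.1 hτi),
        Finset.mem_univ _, funext hτ⟩
  · rw [Finset.sum_eq_zero]
    · exact zero_mem _
    · intro ρ hρ
      exact hF0 ρ fun hi => hs ⟨ρ, hi, (Finset.mem_filter.1 hρ).2⟩

section Lattice

variable {A K E : Type*} [CommRing A] [Field K] [Algebra A K] [AddCommGroup E] [Module K E]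
  [Module A E] [IsScalarTower A K E] {r : ℕ} (b : Module.Basis (Fin r) K E) (M : Submodule A E)

/-- The scalar `c` multiplies every determinant, with respect to the basis `b`, of `r` elements
of `M` into `A`. -/
def IsDetMultiplier (c : K) : Prop :=
  ∀ n : Fin r → E, (∀ j, n j ∈ M) → c * b.det n ∈ (algebraMap A K).range

/-- The products `c * det(n₁, …, nᵣ)` with all `nⱼ ∈ M` and `c` a multiplier of the determinants
of `M` into `A`. Their sums form the product of the determinant module `Λ` of `M` with `(A : Λ)`, so
`Λ` is invertible exactly when `1` is such a sum. -/
def detProducts : Set K :=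
  {x | ∃ c, IsDetMultiplier b M c ∧ ∃ n : Fin r → E, (∀ j, n j ∈ M) ∧ x = c * b.det n}

/-- Cramer's rule with respect to a basis. -/
theorem Module.Basis.sum_det_update_smul (n : Fin r → E) (m : E) :
    ∑ j, b.det (Function.update n j m) • n j = b.det n • m := by
  have h := Matrix.mulVec_cramer (b.toMatrix n) (b.repr m)
  apply b.repr.injective
  ext i
  have hi := congrFun h i
  simp only [Matrix.mulVec, dotProduct, Matrix.cramer_apply, Pi.smul_apply, smul_eq_mul,
    Module.Basis.toMatrix_apply] at hi
  simp only [map_sum, map_smul, Finsupp.coe_finsetSum, Finset.sum_apply, Finsupp.smul_apply,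
    smul_eq_mul, Module.Basis.det_apply]
  rw [← hi]
  refine Finset.sum_congr rfl fun j _ => ?_
  rw [mul_comm, Module.Basis.toMatrix_update]

/-- Multiplication by an element `c * det(n₁, …, nᵣ)` of `detProducts b M` factors through a free
`A`-module: by Cramer's rule `c det(n) m = ∑ⱼ (c det(n₁, …, m, …, nᵣ)) nⱼ`, with coefficients
in `A`. -/
theorem exists_section_smul_of_mem_detProducts [FaithfulSMul A K] {x : K}
    (hx : x ∈ detProducts b M) :
    ∃ s : M →ₗ[A] M →₀ A,
      ∀ m : M, ((Finsupp.linearCombination A id (s m) : M) : E) = x • (m : E) := by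
  obtain ⟨c, hc, n, hn, rfl⟩ := hx
  let e : A ≃ₗ[A] LinearMap.range (Algebra.linearMap A K) :=
    LinearEquiv.ofInjective _ (FaithfulSMul.algebraMap_injective A K)
  let φ' (j : Fin r) : M →ₗ[A] K :=
    ((c • b.det.toMultilinearMap.toLinearMap n j : E →ₗ[K] K).restrictScalars A).comp M.subtype
  have hφ' : ∀ j m, φ' j m = c * b.det (Function.update n j (m : E)) := fun j m => rfl
  have hmem : ∀ j m, φ' j m ∈ LinearMap.range (Algebra.linearMap A K) := by
    intro j m
    refine hc _ fun i => ?_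
    rcases eq_or_ne i j with rfl | h
    · simp
    · simpa [h] using hn i
  let φ (j : Fin r) : M →ₗ[A] A := e.symm.toLinearMap.comp ((φ' j).codRestrict _ (hmem j))
  have hφ : ∀ j m, algebraMap A K (φ j m) = φ' j m := fun j m =>
    congrArg Subtype.val (e.apply_symm_apply ⟨φ' j m, hmem j m⟩)
  refine ⟨∑ j, (Finsupp.lsingle ⟨n j, hn j⟩).comp (φ j), fun m => ?_⟩
  simp only [LinearMap.sum_apply, map_sum, LinearMap.comp_apply, Finsupp.lsingle_apply,
    Finsupp.linearCombination_single, id, AddSubmonoidClass.coe_finsetSum, Submodule.coe_smul]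
  rw [mul_smul, ← b.sum_det_update_smul n m, Finset.smul_sum]
  refine Finset.sum_congr rfl fun j _ => ?_
  rw [← algebraMap_smul K, hφ, hφ', mul_smul]

/-- A submodule of a vector space whose determinant module is invertible is projective. -/
theorem projective_of_one_mem_closure_detProducts [FaithfulSMul A K]
    (h : (1 : K) ∈ AddSubmonoid.closure (detProducts b M)) : Module.Projective A M := by
  suffices H : ∀ x ∈ AddSubmonoid.closure (detProducts b M), ∃ s : M →ₗ[A] M →₀ A,
      ∀ m : M, ((Finsupp.linearCombination A id (s m) : M) : E) = x • (m : E) by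
    obtain ⟨s, hs⟩ := H 1 h
    -- at `x = 1` this is a splitting of the canonical surjection onto `M` from a free module
    exact ⟨⟨s, fun m => Subtype.ext ((hs m).trans (one_smul K _))⟩⟩
  intro x hx
  induction hx using AddSubmonoid.closure_induction with
  | mem x hx => exact exists_section_smul_of_mem_detProducts b M hx
  | zero => exact ⟨0, fun m => by simp⟩
  | add x y _ _ hx hy =>
    obtain ⟨s, hs⟩ := hx
    obtain ⟨t, ht⟩ := hy
    exact ⟨s + t, fun m => by simp [add_smul, ← hs m, ← ht m]⟩

variable {M} in
/-- An `A`-linear form on a lattice `M` extends to a `K`-linear form on the ambient space, which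
is the localization of `M` at the nonzero elements of `A`. -/
theorem exists_linearMap_extending [IsFractionRing A K] (hM : Submodule.span K (M : Set E) = ⊤)
    (φ : M →ₗ[A] A) : ∃ φ' : E →ₗ[K] K, ∀ m : M, φ' m = algebraMap A K (φ m) := by
  have : IsLocalizedModule A⁰ M.subtype := by
    refine ⟨fun a => ?_, fun e => ?_, fun h => ⟨1, by simpa using h⟩⟩
    · rw [Module.End.isUnit_iff]
      have ha : algebraMap A K a ≠ 0 := (IsLocalization.map_units K a).ne_zero
      constructor
      · intro x y hxy
        simp only [Module.algebraMap_end_apply] at hxy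
        rw [← algebraMap_smul K (a : A) x, ← algebraMap_smul K (a : A) y] at hxy
        exact smul_right_injective E ha hxy
      · intro x
        refine ⟨(algebraMap A K a)⁻¹ • x, ?_⟩
        rw [Module.algebraMap_end_apply, ← algebraMap_smul K, smul_inv_smul₀ ha]
    · have he : e ∈ Submodule.span K (M : Set E) := hM ▸ Submodule.mem_top
      suffices ∃ s ∈ A⁰, s • e ∈ M by
        obtain ⟨s, hs, h⟩ := this
        exact ⟨⟨⟨_, h⟩, ⟨s, hs⟩⟩, rfl⟩
      induction he using Submodule.span_induction with
      | mem x hx => exact ⟨1, one_mem _, by simpa using hx⟩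
      | zero => exact ⟨1, one_mem _, by simp⟩
      | add x y _ _ hx hy =>
        obtain ⟨s, hs, hsx⟩ := hx
        obtain ⟨t, ht, hty⟩ := hy
        refine ⟨s * t, mul_mem hs ht, ?_⟩
        rw [smul_add, mul_comm, mul_smul, mul_comm, mul_smul]
        exact add_mem (M.smul_mem _ hsx) (M.smul_mem _ hty)
      | smul c x _ hx =>
        obtain ⟨s, hs, hsx⟩ := hx
        obtain ⟨a, t, rfl⟩ := IsLocalization.exists_mk'_eq A⁰ c
        refine ⟨s * t, mul_mem hs t.2, ?_⟩
        rw [mul_smul, ← algebraMap_smul K (t : A), smul_smul, mul_comm (algebraMap A K t),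
          IsLocalization.mk'_spec, algebraMap_smul, smul_comm]
        exact M.smul_mem _ hsx
  have hu : ∀ x : A⁰, IsUnit (algebraMap A (Module.End A K) x) := by
    intro a
    have ha : algebraMap A K a ≠ 0 := (IsLocalization.map_units K a).ne_zero
    rw [Module.End.isUnit_iff]
    constructor
    · intro x y hxy
      simp only [Module.algebraMap_end_apply, Algebra.smul_def] at hxy
      exact mul_left_cancel₀ ha hxy
    · intro x
      refine ⟨(algebraMap A K a)⁻¹ * x, ?_⟩
      rw [Module.algebraMap_end_apply, Algebra.smul_def, mul_inv_cancel_left₀ ha]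
  refine ⟨(IsLocalizedModule.lift A⁰ M.subtype ((Algebra.linearMap A K).comp φ)
    hu).extendScalarsOfIsLocalization A⁰ K, fun m => ?_⟩
  exact IsLocalizedModule.lift_apply A⁰ M.subtype _ hu m

/-- The determinant module of a finite projective lattice is invertible. If `mᵢ`, `φᵢ` is a finite
dual basis of `M`, then `∑ᵢ φᵢ ⊗ mᵢ` is the identity of `E`, and the Cauchy-Binet formula writes its
determinant `1` as a sum of products of minors of `(φᵢ)` and of `(mᵢ)`. -/
theorem one_mem_closure_detProducts [IsFractionRing A K] [Module.Finite A M]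
    [Module.Projective A M] (hM : Submodule.span K (M : Set E) = ⊤) :
    (1 : K) ∈ AddSubmonoid.closure (detProducts b M) := by
  obtain ⟨n, f, g, -, -, hfg⟩ := Module.Finite.exists_comp_eq_id_of_projective A M
  let m : Fin n → E := fun i => (f (Pi.single i 1) : M)
  have hext := fun i : Fin n => exists_linearMap_extending (K := K) hM ((LinearMap.proj i).comp g)
  choose φ hφ using hext
  have hMid : ∀ x ∈ M, ∑ i, φ i x • m i = x := by
    intro x hx
    have h1 := congrArg Subtype.val (LinearMap.congr_fun hfg ⟨x, hx⟩)
    simp only [LinearMap.comp_apply, LinearMap.id_apply] at h1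
    rw [pi_eq_sum_univ' (g ⟨x, hx⟩)] at h1
    simp only [map_sum, map_smul, AddSubmonoidClass.coe_finsetSum, Submodule.coe_smul] at h1
    refine Eq.trans (Finset.sum_congr rfl fun i _ => ?_) h1
    rw [hφ i ⟨x, hx⟩, algebraMap_smul]
    rfl
  have hid : ∀ x, ∑ i, φ i x • m i = x := by
    intro x
    have : (∑ i, (φ i).smulRight (m i)) = LinearMap.id := by
      refine LinearMap.ext_on hM fun x hx => ?_
      simpa using hMid x hx
    simpa using LinearMap.congr_fun this x
  let X : Matrix (Fin r) (Fin n) K := Matrix.of fun j i => φ i (b j)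
  let Y : Matrix (Fin n) (Fin r) K := Matrix.of fun i j => b.repr (m i) j
  have hXY : X * Y = 1 := by
    ext j l
    have := congrArg (fun v => b.repr v l) (hid (b j))
    simp only [map_sum, map_smul, Finsupp.coe_finsetSum, Finset.sum_apply, Finsupp.smul_apply,
      smul_eq_mul, Module.Basis.repr_self] at this
    simpa [X, Y, Matrix.mul_apply, Matrix.one_apply, Finsupp.single_apply] using this
  have hdet := Matrix.det_mul_mem_closure_minors X Y
  rw [hXY, Matrix.det_one] at hdet
  refine AddSubmonoid.closure_mono ?_ hdet
  rintro _ ⟨σ, rfl⟩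
  refine ⟨(X.submatrix id σ).det, fun n' hn' => ?_, m ∘ σ, fun j => (f _).2, ?_⟩
  · -- the minor of `φ` times `det n'` is the determinant of the matrix `(φ (σ i) (n' j))` over `A`
    have hprod : (X.submatrix id σ).transpose * b.toMatrix n' =
        Matrix.of fun i j => φ (σ i) (n' j) := by
      ext i j
      conv_rhs => rw [Matrix.of_apply, ← b.sum_repr (n' j), map_sum]
      simp [Matrix.mul_apply, X, Module.Basis.toMatrix_apply, mul_comm]
    rw [← Matrix.det_transpose, Module.Basis.det_apply, ← Matrix.det_mul, hprod]
    refine ⟨(Matrix.of fun i j => g ⟨n' j, hn' j⟩ (σ i)).det, ?_⟩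
    rw [RingHom.map_det]
    congr 1
    ext i j
    exact (hφ (σ i) ⟨n' j, hn' j⟩).symm
  · rw [Module.Basis.det_apply, ← Matrix.det_transpose (b.toMatrix _)]
    rfl

end Lattice

/-! ### Reduced differentials inside `Hom_K(L, K)` -/

/-- The values of a `K`-multilinear form on the `A`-span of `T` lie in the `A`-span of its values
on `T`. -/
theorem MultilinearMap.map_mem_span_of_forall_mem_span {A K E : Type*} [CommRing A] [CommRing K]
    [Algebra A K] [AddCommGroup E] [Module K E] [Module A E] [IsScalarTower A K E] {ι : Type*}
    [Finite ι] (f : MultilinearMap K (fun _ : ι => E) K) (T : Set E) {n : ι → E}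
    (hn : ∀ j, n j ∈ Submodule.span A T) :
    f n ∈ Submodule.span A {x | ∃ t : ι → E, (∀ j, t j ∈ T) ∧ x = f t} := by
  classical
  have := Fintype.ofFinite ι
  -- one argument at a time is moved from `T` to its span
  suffices H : ∀ (s : Finset ι) (n : ι → E), (∀ j ∈ s, n j ∈ Submodule.span A T) →
      (∀ j ∉ s, n j ∈ T) → f n ∈ Submodule.span A {x | ∃ t : ι → E, (∀ j, t j ∈ T) ∧ x = f t} from
    H Finset.univ n (fun j _ => hn j) (fun j hj => absurd (Finset.mem_univ j) hj)
  intro s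
  induction s using Finset.induction_on with
  | empty => exact fun n _ hn => Submodule.subset_span ⟨n, fun j => hn j (by simp), rfl⟩
  | insert i s hi ih =>
    intro n hn hn'
    suffices H : ∀ e ∈ Submodule.span A T, f (Function.update n i e) ∈
        Submodule.span A {x | ∃ t : ι → E, (∀ j, t j ∈ T) ∧ x = f t} by
      simpa using H (n i) (hn i (Finset.mem_insert_self i s))
    intro e he
    induction he using Submodule.span_induction with
    | mem e he =>
      refine ih _ (fun j hj => ?_) fun j hj => ?_
      · rw [Function.update_of_ne (by rintro rfl; exact hi hj)]
        exact hn j (Finset.mem_insert_of_mem hj)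
      · rcases eq_or_ne j i with rfl | h
        · simpa using he
        · rw [Function.update_of_ne h]
          exact hn' j (by simp [h, hj])
    | zero => simp
    | add x y _ _ hx hy =>
      rw [f.map_update_add]
      exact add_mem hx hy
    | smul a x _ hx =>
      rw [← algebraMap_smul K a x, f.map_update_smul, algebraMap_smul]
      exact Submodule.smul_mem _ a hx

namespace SingularFoliation

variable {k : Type v} {K : Type u} [Field k] [Field K] [Algebra k K] (L : SingularFoliation k K)

/-- The universal reduced differential `d : K → Hom_K(L, K)`, `d x = (δ ↦ δ x)`. -/
def differential : Derivation k K L.Dual where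
  toFun x :=
    { toFun := fun δ => (δ : Derivation k K K) x
      map_add' := fun _ _ => rfl
      map_smul' := fun _ _ => rfl }
  map_add' x y := by ext δ; exact map_add (δ : Derivation k K K) x y
  map_smul' c x := by ext δ; exact (δ : Derivation k K K).map_smul c x
  map_one_eq_zero' := by ext δ; exact (δ : Derivation k K K).map_one_eq_zero
  leibniz' x y := by ext δ; exact (δ : Derivation k K K).leibniz x y

@[simp]
theorem differential_apply (x : K) (δ : L.toSubmodule) :
    L.differential x δ = (δ : Derivation k K K) x := rfl

theorem reducedDifferentials_eq_span (A : Subalgebra k K) :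
    L.reducedDifferentials A = Submodule.span A (L.differential '' A) := by
  rw [reducedDifferentials, LinearMap.range_eq_map, ← KaehlerDifferential.span_range_derivation,
    Submodule.map_span]
  congr 1
  ext x
  constructor
  · rintro ⟨_, ⟨a, rfl⟩, rfl⟩
    exact ⟨a, a.2, by rw [Derivation.liftKaehlerDifferential_comp_D]; rfl⟩
  · rintro ⟨a, ha, rfl⟩
    exact ⟨_, ⟨⟨a, ha⟩, rfl⟩, by rw [Derivation.liftKaehlerDifferential_comp_D]; rfl⟩

/-- The elements of `C` whose reduced differential is a `C`-linear combination of the differentials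
of elements of `T`. By the product rule they form a subalgebra. -/
def differentialSpan (C : Subalgebra k K) (T : Set K) : Subalgebra k K where
  carrier := {x | x ∈ C ∧ L.differential x ∈ Submodule.span C (L.differential '' T)}
  algebraMap_mem' c := ⟨C.algebraMap_mem c, by rw [Derivation.map_algebraMap]; exact zero_mem _⟩
  add_mem' hx hy := ⟨add_mem hx.1 hy.1, by rw [map_add]; exact add_mem hx.2 hy.2⟩
  mul_mem' {x y} hx hy := ⟨mul_mem hx.1 hy.1, by
    rw [Derivation.leibniz]
    exact add_mem (Submodule.smul_mem _ (⟨x, hx.1⟩ : C) hy.2)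
      (Submodule.smul_mem _ (⟨y, hy.1⟩ : C) hx.2)⟩

variable {L} {C : Subalgebra k K} {T : Set K}

theorem subset_differentialSpan (h : T ⊆ C) : T ⊆ L.differentialSpan C T := fun _ hx =>
  ⟨h hx, Submodule.subset_span ⟨_, hx, rfl⟩⟩

theorem inv_mem_differentialSpan {x : K} (hx : x ∈ L.differentialSpan C T) (h : x⁻¹ ∈ C) :
    x⁻¹ ∈ L.differentialSpan C T := by
  refine ⟨h, ?_⟩
  rw [Derivation.leibniz_inv]
  have : -x⁻¹ ^ 2 ∈ C := neg_mem (pow_mem h 2)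
  exact Submodule.smul_mem _ (⟨_, this⟩ : C) hx.2

theorem mem_differentialSpan_of_mul_mem {x y : K} (hy : y ∈ L.differentialSpan C T) (hy' : y⁻¹ ∈ C)
    (hy0 : y ≠ 0) (h : x * y ∈ L.differentialSpan C T) : x ∈ L.differentialSpan C T := by
  have := mul_mem h (inv_mem_differentialSpan hy hy')
  rwa [mul_inv_cancel_right₀ hy0] at this

theorem reducedDifferentials_eq_span_of_le (hT : T ⊆ C) (h : C ≤ L.differentialSpan C T) :
    L.reducedDifferentials C = Submodule.span C (L.differential '' T) := by
  rw [reducedDifferentials_eq_span]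
  refine le_antisymm (Submodule.span_le.2 ?_) (Submodule.span_mono (Set.image_mono hT))
  rintro _ ⟨x, hx, rfl⟩
  exact (h hx).2

/-- The reduced differentials span `Hom_K(L, K)`: a vector field in `L` that kills `C` kills its
fraction field `K`. -/
theorem span_reducedDifferentials_eq_top [FiniteDimensional K L.toSubmodule]
    [IsFractionRing C K] : Submodule.span K (L.reducedDifferentials C : Set L.Dual) = ⊤ := by
  set N := Submodule.span K (L.reducedDifferentials C : Set L.Dual)
  have hd : ∀ x ∈ C, L.differential x ∈ N := fun x hx => by
    refine Submodule.subset_span ?_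
    rw [reducedDifferentials_eq_span]
    exact Submodule.subset_span ⟨x, hx, rfl⟩
  have hN : N.dualCoannihilator = ⊥ := by
    rw [eq_bot_iff]
    intro δ hδ
    rw [Submodule.mem_dualCoannihilator] at hδ
    rw [Submodule.mem_bot]
    ext x
    obtain ⟨a, s, hs, rfl⟩ := IsFractionRing.div_surjective (A := C) x
    have ha := hδ _ (hd a a.2)
    have hb := hδ _ (hd s s.2)
    rw [differential_apply] at ha hb
    have hs0 : (s : K) ≠ 0 := by simpa using nonZeroDivisors.ne_zero hs
    change (δ : Derivation k K K) ((a : K) / s) = 0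
    rw [div_eq_mul_inv, Derivation.leibniz, Derivation.leibniz_inv, ha, hb]
    simp
  rw [← Subspace.dualCoannihilator_dualAnnihilator_eq (W := N), hN]
  simp

end SingularFoliation

section Minor

variable {k : Type v} {K : Type u} [Field k] [Field K] [Algebra k K] {r : ℕ}

/-- The determinants `det (δ_l (t i))` for `t₁, …, tᵣ ∈ T`. -/
def derivationMinors (δ : Fin r → Derivation k K K) (T : Set K) : Set K :=
  {x | ∃ t : Fin r → K, (∀ j, t j ∈ T) ∧ x = (Matrix.of fun i l => δ l (t i)).det}

variable {L : SingularFoliation k K} (δ : Module.Basis (Fin r) K L.toSubmodule)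

/-- In the coordinates of `Hom_K(L, K)` dual to a basis `δ` of `L`, the determinant of
`d t₁, …, d tᵣ` is the determinant of the matrix `(δ_l (t i))`. -/
theorem dualBasis_det_differential (t : Fin r → K) :
    δ.dualBasis.det (fun j => L.differential (t j)) =
      (Matrix.of fun i l => (δ l : Derivation k K K) (t i)).det := by
  rw [Module.Basis.det_apply, ← Matrix.det_transpose]
  congr 1
  ext i l
  simp [Module.Basis.toMatrix_apply]

theorem dualBasis_det_mem_span {C : Subalgebra k K} {T : Set K} {n : Fin r → L.Dual}
    (hn : ∀ j, n j ∈ Submodule.span C (L.differential '' T)) :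
    δ.dualBasis.det n ∈ Submodule.span C
      (derivationMinors (fun l => (δ l : Derivation k K K)) T) := by
  refine Submodule.span_mono ?_
    (δ.dualBasis.det.toMultilinearMap.map_mem_span_of_forall_mem_span _ hn)
  rintro _ ⟨t, ht, rfl⟩
  choose x hx hxt using ht
  obtain rfl : (fun j => L.differential (x j)) = t := funext hxt
  exact ⟨x, hx, dualBasis_det_differential δ x⟩

end Minor

/-! ### Jacobian determinants on the charts of the blowup -/

section JacobianDet

variable {k : Type v} {K : Type u} [Field k] [Field K] [Algebra k K] {r : ℕ}
  (δ : Fin r → Derivation k K K)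

/-- Multiplying all functions by `f` multiplies the Jacobian determinant by `f ^ (r + 1)`: by the
product rule the new matrix is the old one times a triangular matrix with diagonal entries `f`. -/
theorem det_jacobianMatrix_mul (f : K) (g : Fin (r + 1) → K) :
    (jacobianMatrix δ fun i => f * g i).det = (jacobianMatrix δ g).det * f ^ (r + 1) := by
  let U : Matrix (Fin (r + 1)) (Fin (r + 1)) K :=
    Matrix.of (Fin.cons (Fin.cons f fun l => δ l f) fun j =>
      Fin.cons 0 fun l => if j = l then f else 0)
  have hU : U.det = f ^ (r + 1) := by
    rw [Matrix.det_of_isUpperTriangular]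
    · rw [Fin.prod_univ_succ]
      simp [U, pow_succ']
    · intro i j hij
      induction i using Fin.cases with
      | zero => exact absurd hij (by simp)
      | succ i =>
        induction j using Fin.cases with
        | zero => simp [U]
        | succ j =>
          have : i ≠ j := by rintro rfl; exact absurd hij (lt_irrefl _)
          simp [U, this]
  rw [← hU, ← Matrix.det_mul]
  congr 1
  ext i j
  rw [Matrix.mul_apply, Fin.sum_univ_succ]
  induction j using Fin.cases with
  | zero => simp [U, jacobianMatrix, mul_comm]
  | succ j => simp [U, jacobianMatrix, mul_comm, add_comm]

theorem det_jacobianMatrix_cons_one (t : Fin r → K) :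
    (jacobianMatrix δ (Fin.cons 1 t)).det = (Matrix.of fun i l => δ l (t i)).det := by
  rw [Matrix.det_succ_row_zero, Fin.sum_univ_succ]
  simp only [jacobianMatrix, Matrix.of_apply, Fin.cons_zero, Fin.cons_succ,
    Derivation.map_one_eq_zero, mul_zero, zero_mul, Finset.sum_const_zero, add_zero]
  simp only [Fin.val_zero, pow_zero, one_mul]
  congr 1

theorem det_jacobianMatrix_eq_sum (g : Fin (r + 1) → K) :
    (jacobianMatrix δ g).det =
      ∑ i : Fin (r + 1), (-1) ^ (i : ℕ) * g i *
        (Matrix.of fun j l => δ l (g (i.succAbove j))).det := by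
  rw [Matrix.det_succ_column_zero]
  rfl

end JacobianDet

section Away

variable {k : Type v} {R K : Type u} [Field k] [CommRing R] [Field K]
  [Algebra k R] [Algebra R K] [Algebra k K] [IsScalarTower k R K]

/-- The subalgebra `C` of `K` is the localization `A[1/g]`, for a nonzero `g ∈ A`. -/
structure IsAwaySubalgebra (A C : Subalgebra R K) (g : K) : Prop where
  le : A ≤ C
  mem : g ∈ A
  ne_zero : g ≠ 0
  inv_mem : g⁻¹ ∈ C
  exists_mul_pow_mem : ∀ x ∈ C, ∃ n : ℕ, x * g ^ n ∈ A

/-- Differentials localize: if the differentials of `A` are in the `A[1/g]`-span of those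
of `T`, then so are the differentials of `A[1/g]`, by the quotient rule. -/
theorem IsAwaySubalgebra.le_differentialSpan {L : SingularFoliation k K} {A C : Subalgebra R K}
    {g : K} (h : IsAwaySubalgebra A C g) {T : Set K}
    (hA : A.restrictScalars k ≤ L.differentialSpan (C.restrictScalars k) T) :
    C.restrictScalars k ≤ L.differentialSpan (C.restrictScalars k) T := by
  intro x hx
  obtain ⟨n, hn⟩ := h.exists_mul_pow_mem x hx
  refine SingularFoliation.mem_differentialSpan_of_mul_mem (y := g ^ n) (pow_mem (hA h.mem) n) ?_
    (pow_ne_zero n h.ne_zero) (hA hn)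
  rw [← inv_pow]
  exact pow_mem h.inv_mem n

theorem IsAwaySubalgebra.exists_mul_pow_mem_mul {A C : Subalgebra R K} {g : K}
    (h : IsAwaySubalgebra A C g) {P : Submodule R K} {x : K}
    (hx : x ∈ Subalgebra.toSubmodule C * P) :
    ∃ n : ℕ, x * g ^ n ∈ Subalgebra.toSubmodule A * P := by
  induction hx using Submodule.mul_induction_on' with
  | mem_mul_mem c hc p hp =>
    obtain ⟨n, hn⟩ := h.exists_mul_pow_mem c hc
    refine ⟨n, ?_⟩
    rw [mul_right_comm]
    exact Submodule.mul_mem_mul hn hp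
  | add x _ y _ hx hy =>
    obtain ⟨n, hn⟩ := hx
    obtain ⟨m, hm⟩ := hy
    have key : ∀ z ∈ Subalgebra.toSubmodule A * P, ∀ n : ℕ,
        z * g ^ n ∈ Subalgebra.toSubmodule A * P := by
      intro z hz n
      rw [mul_comm z, ← A.isIdempotentElem_toSubmodule.eq, mul_assoc]
      exact Submodule.mul_mem_mul (pow_mem h.mem n) hz
    refine ⟨n + m, ?_⟩
    rw [add_mul]
    refine add_mem ?_ ?_
    · rw [pow_add, ← mul_assoc]
      exact key _ hn m
    · rw [add_comm, pow_add, ← mul_assoc]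
      exact key _ hm n

theorem mem_toSubmodule_mul_span {A : Subalgebra R K} {T : Set K} {x : K}
    (hx : x ∈ Submodule.span (A.restrictScalars k) T) :
    x ∈ Subalgebra.toSubmodule A * Submodule.span R T := by
  induction hx using Submodule.span_induction with
  | mem x hx =>
    rw [← one_mul x]
    exact Submodule.mul_mem_mul (one_mem A) (Submodule.subset_span hx)
  | zero => exact zero_mem _
  | add x y _ _ hx hy => exact add_mem hx hy
  | smul a x _ hx =>
    rw [← A.isIdempotentElem_toSubmodule.eq, mul_assoc]
    exact Submodule.mul_mem_mul (m := (a : K)) a.2 hx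

theorem mem_span_restrictScalars {A : Subalgebra R K} {T : Set K} {x : K}
    (hx : x ∈ Submodule.span R T) : x ∈ Submodule.span (A.restrictScalars k) T := by
  induction hx using Submodule.span_induction with
  | mem x hx => exact Submodule.subset_span hx
  | zero => exact zero_mem _
  | add x y _ _ hx hy => exact add_mem hx hy
  | smul a x _ hx =>
    rw [Algebra.smul_def]
    exact Submodule.smul_mem _ (⟨_, A.algebraMap_mem a⟩ : A.restrictScalars k) hx

theorem finiteType_restrictScalars [Algebra.FiniteType k R] {A : Subalgebra R K}
    (hA : Algebra.FiniteType R A) : Algebra.FiniteType k (A.restrictScalars k) := by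
  have h : (algebraMap k (A.restrictScalars k)).FiniteType := by
    have : algebraMap k (A.restrictScalars k) = (algebraMap R A).comp (algebraMap k R) :=
      RingHom.ext fun x => Subtype.ext (IsScalarTower.algebraMap_apply k R K x)
    rw [this]
    exact (RingHom.finiteType_algebraMap.2 hA).comp (RingHom.finiteType_algebraMap.2 inferInstance)
  exact RingHom.finiteType_algebraMap.1 h

end Away

section Chart

variable {k : Type v} {R K : Type u} [Field k] [CommRing R] [Field K]
  [Algebra k R] [Algebra R K] [Algebra k K] [IsScalarTower k R K] (I : Ideal R) (f : R)

variable (K) in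
/-- The set `I/f` of the fractions `a/f` with `a ∈ I`, described without division, so that it is
meaningful only if `f` is nonzero in `K`. If `f ∈ I`, it contains `R`. -/
def chartGenerators : Set K := {x | ∃ a ∈ I, x * algebraMap R K f = algebraMap R K a}

variable (K) in
/-- The coordinate ring `R[I/f]` of the chart `D₊(f t)` of the blowup. -/
def chartAlgebra : Subalgebra R K := Algebra.adjoin R (chartGenerators K I f)

variable {I f}

theorem algebraMap_mem_chartGenerators (hf : f ∈ I) (a : R) :
    algebraMap R K a ∈ chartGenerators K I f :=
  ⟨a * f, I.mul_mem_left a hf, (map_mul _ _ _).symm⟩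

theorem exists_mul_pow_eq_of_mem_chartAlgebra (hf : f ∈ I) {x : K} (hx : x ∈ chartAlgebra K I f) :
    ∃ n, ∃ a ∈ I ^ n, x * algebraMap R K f ^ n = algebraMap R K a := by
  induction hx using Algebra.adjoin_induction with
  | mem x hx =>
    obtain ⟨a, ha, h⟩ := hx
    exact ⟨1, a, (pow_one I).symm ▸ ha, by rwa [pow_one]⟩
  | algebraMap a => exact ⟨0, a, by simp, by simp⟩
  | add x y _ _ hx hy =>
    obtain ⟨n, a, ha, hxa⟩ := hx
    obtain ⟨m, b, hb, hyb⟩ := hy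
    refine ⟨n + m, a * f ^ m + f ^ n * b, ?_, ?_⟩
    · rw [pow_add]
      exact add_mem (Ideal.mul_mem_mul ha (Ideal.pow_mem_pow hf m))
        (Ideal.mul_mem_mul (Ideal.pow_mem_pow hf n) hb)
    · rw [map_add, map_mul, map_mul, ← hxa, ← hyb, map_pow, map_pow]
      ring
  | mul x y _ _ hx hy =>
    obtain ⟨n, a, ha, hxa⟩ := hx
    obtain ⟨m, b, hb, hyb⟩ := hy
    refine ⟨n + m, a * b, ?_, ?_⟩
    · rw [pow_add]
      exact Ideal.mul_mem_mul ha hb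
    · rw [map_mul, ← hxa, ← hyb]
      ring

theorem mem_chartAlgebra_of_mul_pow_eq (hf0 : algebraMap R K f ≠ 0) {n : ℕ} {a : R} {x : K}
    (ha : a ∈ I ^ n) (h : x * algebraMap R K f ^ n = algebraMap R K a) :
    x ∈ chartAlgebra K I f := by
  obtain rfl : x = algebraMap R K a / algebraMap R K f ^ n :=
    (eq_div_iff (pow_ne_zero n hf0)).2 h
  clear h
  induction n generalizing a with
  | zero => simp
  | succ n ih =>
    rw [pow_succ] at ha
    induction ha using Submodule.mul_induction_on' with
    | mem_mul_mem b hb c hc =>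
      have h1 : algebraMap R K c / algebraMap R K f ∈ chartAlgebra K I f :=
        Algebra.subset_adjoin ⟨c, hc, div_mul_cancel₀ _ hf0⟩
      rw [map_mul, pow_succ, mul_div_mul_comm]
      exact mul_mem (ih hb) h1
    | add b _ c _ hb hc =>
      rw [map_add, add_div]
      exact add_mem hb hc

/-- Over any `C` containing `R[I/f]`, the differentials of `R[I/f]` are spanned by those of `I/f`:
since `R ⊆ I/f`, this set generates `R[I/f]` even as a `k`-algebra. -/
theorem chartAlgebra_le_differentialSpan (L : SingularFoliation k K) (hf : f ∈ I)
    {C : Subalgebra R K} (hC : chartAlgebra K I f ≤ C) :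
    (chartAlgebra K I f).restrictScalars k ≤
      L.differentialSpan (C.restrictScalars k) (chartGenerators K I f) := by
  have hT : chartGenerators K I f ⊆
      L.differentialSpan (C.restrictScalars k) (chartGenerators K I f) :=
    SingularFoliation.subset_differentialSpan fun x hx => hC (Algebra.subset_adjoin hx)
  intro x hx
  change x ∈ Algebra.adjoin R _ at hx
  induction hx using Algebra.adjoin_induction with
  | mem x hx => exact hT hx
  | algebraMap a => exact hT (algebraMap_mem_chartGenerators hf a)
  | add x y _ _ hx hy => exact add_mem hx hy
  | mul x y _ _ hx hy => exact mul_mem hx hy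

theorem chartAlgebra_finiteType [IsNoetherianRing R] (hf0 : algebraMap R K f ≠ 0) :
    Algebra.FiniteType R (chartAlgebra K I f) := by
  classical
  obtain ⟨s, hs⟩ := IsNoetherian.noetherian I
  rw [← Subalgebra.fg_iff_finiteType]
  refine ⟨s.image fun a => algebraMap R K a / algebraMap R K f, le_antisymm ?_ ?_⟩
  · refine Algebra.adjoin_mono fun x hx => ?_
    obtain ⟨a, ha, rfl⟩ := Finset.mem_image.1 hx
    exact ⟨a, hs ▸ Submodule.subset_span ha, div_mul_cancel₀ _ hf0⟩
  · refine Algebra.adjoin_le ?_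
    rintro x ⟨a, ha, hx⟩
    obtain rfl : x = algebraMap R K a / algebraMap R K f := (eq_div_iff hf0).2 hx
    clear hx
    rw [← hs] at ha
    induction ha using Submodule.span_induction with
    | mem a ha => exact Algebra.subset_adjoin (Finset.mem_image_of_mem _ ha)
    | zero => simp
    | add a b _ _ ha hb =>
      rw [map_add, add_div]
      exact add_mem ha hb
    | smul c a _ ha =>
      rw [smul_eq_mul, map_mul, mul_div_assoc]
      exact mul_mem (Subalgebra.algebraMap_mem _ c) ha

theorem isFractionRing_restrictScalars [IsDomain R] [IsFractionRing R K] (A : Subalgebra R K) :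
    IsFractionRing (A.restrictScalars k) K := by
  refine IsFractionRing.of_field _ _ fun z => ?_
  obtain ⟨a, b, -, rfl⟩ := IsFractionRing.div_surjective (A := R) z
  exact ⟨⟨_, A.algebraMap_mem a⟩, ⟨_, A.algebraMap_mem b⟩, rfl⟩

/-- On a chart the ideal `I` becomes principal, generated by `f`. -/
theorem toSubmodule_mul_coeIdeal {C : Subalgebra R K} (hC : chartGenerators K I f ⊆ C)
    (hf : f ∈ I) (hf0 : algebraMap R K f ≠ 0) :
    Subalgebra.toSubmodule C * ((I : FractionalIdeal R⁰ K) : Submodule R K) =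
      Subalgebra.toSubmodule C * Submodule.span R {algebraMap R K f} := by
  refine le_antisymm ?_ (mul_le_mul_right ?_ _)
  · refine Submodule.mul_le.2 fun c hc x hx => ?_
    obtain ⟨a, ha, rfl⟩ := (FractionalIdeal.mem_coeIdeal _).1 hx
    have : c * algebraMap R K a = c * (algebraMap R K a / algebraMap R K f) * algebraMap R K f := by
      field_simp
    rw [this]
    exact Submodule.mul_mem_mul (C.mul_mem hc (hC ⟨a, ha, div_mul_cancel₀ _ hf0⟩))
      (Submodule.mem_span_singleton_self _)
  · rw [Submodule.span_singleton_le_iff_mem]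
    exact FractionalIdeal.mem_coeIdeal_of_mem _ hf

theorem toSubmodule_mul_coeIdeal_pow {C : Subalgebra R K} (hC : chartGenerators K I f ⊆ C)
    (hf : f ∈ I) (hf0 : algebraMap R K f ≠ 0) (n : ℕ) :
    Subalgebra.toSubmodule C * ((I : FractionalIdeal R⁰ K) : Submodule R K) ^ n =
      Subalgebra.toSubmodule C * Submodule.span R {algebraMap R K f ^ n} := by
  induction n with
  | zero => rw [pow_zero, pow_zero, ← Submodule.one_eq_span]
  | succ n ih =>
    rw [pow_succ, ← mul_assoc, ih, mul_right_comm, toSubmodule_mul_coeIdeal hC hf hf0,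
      mul_assoc, Submodule.span_mul_span, Set.singleton_mul_singleton, pow_succ']

theorem mul_pow_mem_jacobianIdeal [Algebra.FiniteType k R] [IsFractionRing R K] {r : ℕ}
    (δ : Fin r → Derivation k K K) (hf : f ∈ I) {x : K}
    (hx : x ∈ derivationMinors δ (chartGenerators K I f)) :
    x * algebraMap R K f ^ (r + 1) ∈
      (jacobianIdeal δ (I : FractionalIdeal R⁰ K) : Submodule R K) := by
  obtain ⟨t, ht, rfl⟩ := hx
  refine Submodule.subset_span
    ⟨fun i => algebraMap R K f * Fin.cons (α := fun _ => K) 1 t i, ?_, ?_⟩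
  · intro i
    rw [FractionalIdeal.mem_coeIdeal]
    induction i using Fin.cases with
    | zero => exact ⟨f, hf, by simp⟩
    | succ i =>
      obtain ⟨a, ha, h⟩ := ht i
      exact ⟨a, ha, by simp only [Fin.cons_succ, mul_comm, ← h]⟩
  · rw [det_jacobianMatrix_mul, det_jacobianMatrix_cons_one]

/-- On a chart, `𝒥(I)` is `f ^ (r + 1)` times the module generated by the determinants
`det (δ_l (t i))` with `t i ∈ I/f`. For one inclusion the Jacobian determinant of `1, t₁, …, tᵣ` is
`det (δ_l (t i))`, for the other a Jacobian determinant is expanded along its first column. -/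
theorem toSubmodule_mul_jacobianIdeal [Algebra.FiniteType k R] [IsFractionRing R K] {r : ℕ}
    (δ : Fin r → Derivation k K K) {C : Subalgebra R K} (hC : chartGenerators K I f ⊆ C)
    (hf : f ∈ I) (hf0 : algebraMap R K f ≠ 0) :
    Subalgebra.toSubmodule C * Submodule.span R (derivationMinors δ (chartGenerators K I f)) *
        Submodule.span R {algebraMap R K f ^ (r + 1)} =
      Subalgebra.toSubmodule C * (jacobianIdeal δ (I : FractionalIdeal R⁰ K) : Submodule R K) := by
  refine le_antisymm ?_ ?_
  · rw [mul_assoc, Submodule.span_mul_span]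
    refine mul_le_mul_right (Submodule.span_le.2 ?_) _
    rintro _ ⟨x, hx, _, rfl, rfl⟩
    exact mul_pow_mem_jacobianIdeal δ hf hx
  · refine Submodule.mul_le.2 fun c hc x hx => ?_
    change x ∈ Submodule.span R _ at hx
    induction hx using Submodule.span_induction with
    | mem x hx =>
      obtain ⟨g, hg, rfl⟩ := hx
      let t : Fin (r + 1) → K := fun i => g i / algebraMap R K f
      have ht : ∀ i, t i ∈ chartGenerators K I f := fun i => by
        obtain ⟨a, ha, h⟩ := (FractionalIdeal.mem_coeIdeal _).1 (hg i)
        exact ⟨a, ha, by simp [t, h, div_mul_cancel₀ _ hf0]⟩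
      have hgt : g = fun i => algebraMap R K f * t i := by
        ext i
        exact (mul_div_cancel₀ _ hf0).symm
      rw [hgt, det_jacobianMatrix_mul, ← mul_assoc]
      refine Submodule.mul_mem_mul ?_ (Submodule.mem_span_singleton_self _)
      rw [det_jacobianMatrix_eq_sum, Finset.mul_sum]
      refine sum_mem fun i _ => ?_
      rw [← mul_assoc]
      refine Submodule.mul_mem_mul (C.mul_mem hc (C.mul_mem ?_ (hC (ht i))))
        (Submodule.subset_span ⟨_, fun j => ht _, rfl⟩)
      exact pow_mem (neg_mem (one_mem C)) _
    | zero => simp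
    | add x y _ _ hx hy =>
      rw [mul_add]
      exact add_mem hx hy
    | smul a x _ hx =>
      rw [mul_smul_comm]
      exact Submodule.smul_mem _ a hx

end Chart

/-! ### From projective differentials to divisors of powers of `I` -/

section Criterion

variable {k : Type v} {K : Type u} [Field k] [Field K] [Algebra k K] {r : ℕ}
  {L : SingularFoliation k K} (δ : Module.Basis (Fin r) K L.toSubmodule) {C : Subalgebra k K}
  {T : Set K}

/-- If the differentials of `T` span those of `C`, the multipliers of the determinants of
`L.reducedDifferentials C` into `C` are those of the minors `det (δ_l (t i))` with `t i ∈ T`. -/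
theorem isDetMultiplier_iff (hT : T ⊆ C) (h : C ≤ L.differentialSpan C T) {c : K} :
    IsDetMultiplier δ.dualBasis (L.reducedDifferentials C) c ↔
      ∀ x ∈ Submodule.span C (derivationMinors (fun l => (δ l : Derivation k K K)) T),
        c * x ∈ C := by
  have hM := L.reducedDifferentials_eq_span_of_le hT h
  constructor
  · intro hc x hx
    induction hx using Submodule.span_induction with
    | mem x hx =>
      obtain ⟨t, ht, rfl⟩ := hx
      rw [← dualBasis_det_differential]
      obtain ⟨y, hy⟩ := hc (fun j => L.differential (t j)) fun j => by
        rw [hM]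
        exact Submodule.subset_span ⟨_, ht j, rfl⟩
      rw [← hy]
      exact y.2
    | zero => simp
    | add x y _ _ hx hy =>
      rw [mul_add]
      exact add_mem hx hy
    | smul a x _ hx =>
      rw [mul_smul_comm]
      exact mul_mem a.2 hx
  · intro hc n hn
    exact ⟨⟨_, hc _ (dualBasis_det_mem_span δ fun j => hM ▸ hn j)⟩, rfl⟩

theorem projective_reducedDifferentials (hT : T ⊆ C) (h : C ≤ L.differentialSpan C T)
    (h1 : (1 : K) ∈ AddSubmonoid.closure
      {y | ∃ c, (∀ x ∈ Submodule.span C (derivationMinors (fun l => (δ l : Derivation k K K)) T),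
        c * x ∈ C) ∧ ∃ x ∈ derivationMinors (fun l => (δ l : Derivation k K K)) T, y = c * x}) :
    Module.Projective C (L.reducedDifferentials C) := by
  refine projective_of_one_mem_closure_detProducts δ.dualBasis _
    (AddSubmonoid.closure_mono ?_ h1)
  rintro _ ⟨c, hc, _, ⟨t, ht, rfl⟩, rfl⟩
  refine ⟨c, (isDetMultiplier_iff δ hT h).2 hc, fun j => L.differential (t j), fun j => ?_, ?_⟩
  · rw [L.reducedDifferentials_eq_span_of_le hT h]
    exact Submodule.subset_span ⟨_, ht j, rfl⟩
  · rw [dualBasis_det_differential]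

theorem one_mem_closure_of_projective [Algebra.FiniteType k C] [IsFractionRing C K]
    (hT : T ⊆ C) (h : C ≤ L.differentialSpan C T)
    [Module.Projective C (L.reducedDifferentials C)] :
    (1 : K) ∈ AddSubmonoid.closure
      {y | ∃ c, (∀ x ∈ Submodule.span C (derivationMinors (fun l => (δ l : Derivation k K K)) T),
        c * x ∈ C) ∧ ∃ x ∈ derivationMinors (fun l => (δ l : Derivation k K K)) T, y = c * x} := by
  have : FiniteDimensional K L.toSubmodule := δ.finiteDimensional_of_finite
  have : Module.Finite C (L.reducedDifferentials C) := by
    unfold SingularFoliation.reducedDifferentials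
    infer_instance
  have h1 := one_mem_closure_detProducts δ.dualBasis (L.reducedDifferentials C)
    SingularFoliation.span_reducedDifferentials_eq_top
  refine AddSubmonoid.closure_le.2 ?_ h1
  rintro _ ⟨c, hc, n, hn, rfl⟩
  rw [isDetMultiplier_iff δ hT h] at hc
  rw [L.reducedDifferentials_eq_span_of_le hT h] at hn
  have hd := dualBasis_det_mem_span δ hn
  generalize δ.dualBasis.det n = d at hd
  induction hd using Submodule.span_induction generalizing c with
  | mem x hx => exact AddSubmonoid.subset_closure ⟨c, hc, x, hx, rfl⟩
  | zero => rw [mul_zero]; exact zero_mem _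
  | add x y _ _ hx hy =>
    rw [mul_add]
    exact add_mem (hx c hc) (hy c hc)
  | smul a x _ hx =>
    have : c * a • x = c * (a : K) * x := by
      rw [mul_assoc]
      rfl
    rw [this]
    refine hx _ fun y hy => ?_
    rw [mul_assoc]
    exact hc _ (Submodule.smul_mem _ a hy)

end Criterion

section Powers

variable {R K : Type*} [CommRing R] [Field K] [Algebra R K]

theorem Submodule.natCast_le_one (n : ℕ) : (n : Submodule R K) ≤ 1 := by
  induction n with
  | zero => simp
  | succ n ih =>
    rw [Nat.cast_succ]
    exact sup_le ih le_rfl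

/-- If every element of the finite set `s ⊆ P` has almost all its powers `x ^ m` in `Q m`, and
`Q m * P ^ n ≤ Q (m + n)`, then almost all powers of the span of `s` satisfy
`span s ^ m ≤ Q m`. -/
theorem Submodule.exists_span_pow_le (P : Submodule R K) (Q : ℕ → Submodule R K)
    (hQ : ∀ m n, Q m * P ^ n ≤ Q (m + n)) (s : Finset K) (hsP : (s : Set K) ⊆ P)
    (hs : ∀ x ∈ s, ∃ m₀, ∀ m ≥ m₀, x ^ m ∈ Q m) :
    ∃ m₀, ∀ m ≥ m₀, span R (s : Set K) ^ m ≤ Q m := by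
  classical
  induction s using Finset.induction_on with
  | empty =>
    refine ⟨1, fun m hm => ?_⟩
    rw [Finset.coe_empty, span_empty, ← zero_eq_bot, zero_pow (by omega)]
    exact bot_le
  | insert x s hx ih =>
    obtain ⟨m₁, h₁⟩ := hs x (Finset.mem_insert_self x s)
    obtain ⟨m₂, h₂⟩ := ih (fun y hy => hsP (Finset.mem_insert_of_mem hy))
      fun y hy => hs y (Finset.mem_insert_of_mem hy)
    have hxP : span R {x} ≤ P := by
      rw [span_singleton_le_iff_mem]
      exact hsP (Finset.mem_insert_self x s)
    have hsP' : span R (s : Set K) ≤ P :=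
      span_le.2 fun y hy => hsP (Finset.mem_insert_of_mem hy)
    refine ⟨m₁ + m₂, fun m hm => ?_⟩
    -- in a monomial `x ^ i * y ^ (m - i)` one of the exponents is large enough
    rw [Finset.coe_insert, span_insert, ← add_eq_sup, add_pow]
    refine Finset.sum_induction _ (· ≤ Q m) (fun _ _ ha hb => sup_le ha hb) bot_le
      fun i hi => ?_
    have hi' : i ≤ m := Nat.lt_succ_iff.1 (Finset.mem_range.1 hi)
    refine (mul_le_mul_right (natCast_le_one _) _).trans ?_
    rw [mul_one]
    rcases le_or_gt m₁ i with h | h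
    · have hle : span R {x} ^ i ≤ Q i := by
        rw [span_pow, Set.singleton_pow, span_singleton_le_iff_mem]
        exact h₁ i h
      refine (mul_le_mul' hle (pow_le_pow_left' hsP' _)).trans ((hQ _ _).trans_eq ?_)
      congr 1
      omega
    · have hle := h₂ (m - i) (by omega)
      rw [mul_comm]
      refine (mul_le_mul' hle (pow_le_pow_left' hxP _)).trans ((hQ _ _).trans_eq ?_)
      congr 1
      omega

end Powers

section Chart

variable {k : Type v} {R K : Type u} [Field k] [CommRing R] [IsDomain R] [Algebra k R]
    [Algebra.FiniteType k R] [Field K] [Algebra R K] [IsFractionRing R K] [Algebra k K]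
    [IsScalarTower k R K] {L : SingularFoliation k K} {r : ℕ}
    (δ : Module.Basis (Fin r) K L.toSubmodule) {I : Ideal R} {f : R}

omit [IsDomain R] [IsFractionRing R K] in
/-- If `n J ⊆ R[I/f]` for a finitely generated `J`, then `f ^ m n J ⊆ I ^ m` for all large `m`. -/
theorem exists_pow_mul_forall_mem {J : Submodule R K} (hJ : J.FG) (hf : f ∈ I)
    {n : K} (hn : ∀ x ∈ J, n * x ∈ chartAlgebra K I f) :
    ∃ m₀, ∀ m ≥ m₀, ∀ x ∈ J,
      algebraMap R K f ^ m * n * x ∈ ((I : FractionalIdeal R⁰ K) : Submodule R K) ^ m := by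
  classical
  have hfI : algebraMap R K f ∈ ((I : FractionalIdeal R⁰ K) : Submodule R K) :=
    FractionalIdeal.mem_coeIdeal_of_mem _ hf
  obtain ⟨s, rfl⟩ := hJ
  have hx : ∀ x ∈ s, ∃ m₀, ∀ m ≥ m₀,
      algebraMap R K f ^ m * n * x ∈ ((I : FractionalIdeal R⁰ K) : Submodule R K) ^ m := by
    intro x hx
    obtain ⟨m₀, a, ha, h⟩ := exists_mul_pow_eq_of_mem_chartAlgebra hf
      (hn x (Submodule.subset_span hx))
    refine ⟨m₀, fun m hm => ?_⟩
    obtain ⟨l, rfl⟩ := Nat.exists_eq_add_of_le hm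
    have : algebraMap R K f ^ (m₀ + l) * n * x = algebraMap R K a * algebraMap R K f ^ l := by
      rw [← h]
      ring
    rw [this, pow_add]
    refine Submodule.mul_mem_mul ?_ (Submodule.pow_mem_pow _ hfI l)
    rw [← FractionalIdeal.coe_pow, ← FractionalIdeal.coeIdeal_pow]
    exact FractionalIdeal.mem_coeIdeal_of_mem _ ha
  choose! m₀ hm₀ using hx
  refine ⟨s.sup m₀, fun m hm x hx => ?_⟩
  induction hx using Submodule.span_induction with
  | mem x hx => exact hm₀ x hx m ((Finset.le_sup hx).trans hm)
  | zero => simp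
  | add x y _ _ hx hy =>
    rw [mul_add]
    exact add_mem hx hy
  | smul a x _ hx =>
    rw [mul_smul_comm]
    exact Submodule.smul_mem _ a hx

/-- If the reduced differentials of the chart `R[I/f]` are projective, then
`f ^ m ∈ 𝒥(I) (I ^ m : 𝒥(I))` for all large `m`. Indeed `𝒥(I)` becomes invertible on the chart, so
`1` is a sum of products `y n` with `y ∈ 𝒥(I)` and `n 𝒥(I) ⊆ R[I/f]`, and a high power of `f` clears
the denominators of the factors `n`. -/
theorem exists_pow_mem_mul_div_of_projective (hf : f ∈ I) (hf0 : f ≠ 0)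
    (hproj : Module.Projective ((chartAlgebra K I f).restrictScalars k)
      (L.reducedDifferentials ((chartAlgebra K I f).restrictScalars k))) :
    ∃ m₀, ∀ m ≥ m₀, algebraMap R K f ^ m ∈
      (jacobianIdeal (fun l => (δ l : Derivation k K K)) (I : FractionalIdeal R⁰ K) :
        Submodule R K) *
      (((I : FractionalIdeal R⁰ K) : Submodule R K) ^ m /
        (jacobianIdeal (fun l => (δ l : Derivation k K K)) (I : FractionalIdeal R⁰ K) :
          Submodule R K)) := by
  have : IsNoetherianRing R := Algebra.FiniteType.isNoetherianRing k R
  have hf0' : algebraMap R K f ≠ 0 := by simpa using hf0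
  set J := jacobianIdeal (fun l => (δ l : Derivation k K K)) (I : FractionalIdeal R⁰ K)
  have hJ : (J : Submodule R K).FG :=
    isNoetherian_submodule.1 (FractionalIdeal.isNoetherian J) (J : Submodule R K) le_rfl
  set B := chartAlgebra K I f
  have : IsFractionRing (B.restrictScalars k) K := isFractionRing_restrictScalars B
  have : Algebra.FiniteType k (B.restrictScalars k) :=
    finiteType_restrictScalars (chartAlgebra_finiteType hf0')
  have hTB : chartGenerators K I f ⊆ B := Algebra.subset_adjoin
  have hone := one_mem_closure_of_projective δ (C := B.restrictScalars k) hTB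
    (chartAlgebra_le_differentialSpan L hf le_rfl)
  have hJmul := toSubmodule_mul_jacobianIdeal (fun l => (δ l : Derivation k K K)) hTB hf hf0'
  suffices H : ∀ x ∈ AddSubmonoid.closure {y | ∃ c, (∀ x ∈ Submodule.span (B.restrictScalars k)
      (derivationMinors (fun l => (δ l : Derivation k K K)) (chartGenerators K I f)),
        c * x ∈ B.restrictScalars k) ∧ ∃ x ∈ derivationMinors
        (fun l => (δ l : Derivation k K K)) (chartGenerators K I f), y = c * x},
      ∃ m₀, ∀ m ≥ m₀, algebraMap R K f ^ m * x ∈ (J : Submodule R K) *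
      (((I : FractionalIdeal R⁰ K) : Submodule R K) ^ m / (J : Submodule R K)) by
    simpa using H 1 hone
  intro x hx
  induction hx using AddSubmonoid.closure_induction with
  | zero => exact ⟨0, by simp⟩
  | add x y _ _ hx hy =>
    obtain ⟨m₁, h₁⟩ := hx
    obtain ⟨m₂, h₂⟩ := hy
    refine ⟨m₁ ⊔ m₂, fun m hm => ?_⟩
    rw [mul_add]
    exact add_mem (h₁ m (le_sup_left.trans hm)) (h₂ m (le_sup_right.trans hm))
  | mem x hx =>
    obtain ⟨c, hc, d, hd, rfl⟩ := hx
    have hcJ : ∀ x ∈ (J : Submodule R K), c / algebraMap R K f ^ (r + 1) * x ∈ B := by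
      intro x hx
      have hx' : x ∈ Subalgebra.toSubmodule B * (J : Submodule R K) := by
        rw [← one_mul x]
        exact Submodule.mul_mem_mul (one_mem B) hx
      rw [← hJmul] at hx'
      clear hx
      induction hx' using Submodule.mul_induction_on' with
      | mem_mul_mem y hy z hz =>
        obtain ⟨a, rfl⟩ := Submodule.mem_span_singleton.1 hz
        have hcy : c * y ∈ B := by
          clear hz
          induction hy using Submodule.mul_induction_on' with
          | mem_mul_mem b hb e he =>
            refine hc _ ?_
            refine Submodule.smul_mem _ (⟨b, hb⟩ : B.restrictScalars k) ?_
            exact mem_span_restrictScalars he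
          | add y _ z _ hy hz =>
            rw [mul_add]
            exact add_mem hy hz
        have : c / algebraMap R K f ^ (r + 1) * (y * a • algebraMap R K f ^ (r + 1)) =
            a • (c * y) := by
          rw [Algebra.smul_def, Algebra.smul_def]
          field_simp
        rw [this]
        exact B.smul_mem hcy a
      | add y _ z _ hy hz =>
        rw [mul_add]
        exact add_mem hy hz
    have hdJ : d * algebraMap R K f ^ (r + 1) ∈ (J : Submodule R K) :=
      mul_pow_mem_jacobianIdeal _ hf hd
    obtain ⟨m₀, hm₀⟩ := exists_pow_mul_forall_mem hJ hf hcJ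
    refine ⟨m₀, fun m hm => ?_⟩
    have : algebraMap R K f ^ m * (c * d) = (d * algebraMap R K f ^ (r + 1)) *
        (algebraMap R K f ^ m * (c / algebraMap R K f ^ (r + 1))) := by
      field_simp
    rw [this]
    exact Submodule.mul_mem_mul hdJ
      (Submodule.mem_div_iff_forall_mul_mem.2 fun y hy => hm₀ m hm y hy)

/-- If the reduced differentials of all charts `R[I/f]` are projective, then `𝒥(I)` divides
`I ^ α` for all large `α`, with cofactor `(I ^ α : 𝒥(I))`. -/
theorem exists_mul_jacobianIdeal_eq_pow (hI : I ≠ ⊥)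
    (h : ∀ f ∈ I, f ≠ 0 → Module.Projective ((chartAlgebra K I f).restrictScalars k)
      (L.reducedDifferentials ((chartAlgebra K I f).restrictScalars k))) :
    ∃ (S : FractionalIdeal R⁰ K) (α : ℕ),
      S * jacobianIdeal (fun l => (δ l : Derivation k K K)) (I : FractionalIdeal R⁰ K) =
        (I : FractionalIdeal R⁰ K) ^ α := by
  classical
  have : IsNoetherianRing R := Algebra.FiniteType.isNoetherianRing k R
  set J := jacobianIdeal (fun l => (δ l : Derivation k K K)) (I : FractionalIdeal R⁰ K) with hJdef
  set P : Submodule R K := ((I : FractionalIdeal R⁰ K) : Submodule R K) with hP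
  have hmem : ∀ f ∈ I, ∃ m₀, ∀ m ≥ m₀, algebraMap R K f ^ m ∈
      (J : Submodule R K) * (P ^ m / (J : Submodule R K)) := by
    intro f hf
    rcases eq_or_ne f 0 with rfl | hf0
    · refine ⟨1, fun m hm => ?_⟩
      rw [map_zero, zero_pow (by omega)]
      exact zero_mem _
    · exact exists_pow_mem_mul_div_of_projective δ hf hf0 (h f hf hf0)
  have hJ0 : J ≠ 0 := by
    intro hJ0
    obtain ⟨f, hf, hf0⟩ := Submodule.exists_mem_ne_zero_of_ne_bot hI
    obtain ⟨m, hm⟩ := hmem f hf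
    have h1 := hm m le_rfl
    rw [hJ0, FractionalIdeal.coe_zero, Submodule.bot_mul, Submodule.mem_bot] at h1
    exact pow_ne_zero m (by simpa using hf0) h1
  obtain ⟨s, hs⟩ := IsNoetherian.noetherian I
  have hspan : Submodule.span R ((s.image (algebraMap R K) : Finset K) : Set K) = P := by
    rw [hP, FractionalIdeal.coe_coeIdeal, ← hs, Finset.coe_image]
    exact (Submodule.map_span (Algebra.linearMap R K) (s : Set R)).symm
  obtain ⟨m, hm⟩ := Submodule.exists_span_pow_le P
    (fun m => (J : Submodule R K) * (P ^ m / (J : Submodule R K)))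
    (fun m n => by
      rw [mul_assoc]
      refine mul_le_mul_right ?_ _
      rw [Submodule.le_div_iff_mul_le, mul_right_comm, pow_add]
      exact mul_le_mul_left (Submodule.le_div_iff_mul_le.1 le_rfl) _)
    (s.image (algebraMap R K)) (by rw [← hspan]; exact Submodule.subset_span)
    (fun x hx => by
      obtain ⟨f, hf, rfl⟩ := Finset.mem_image.1 hx
      exact hmem f (hs ▸ Submodule.subset_span hf))
  refine ⟨(I : FractionalIdeal R⁰ K) ^ m / J, m, ?_⟩
  apply FractionalIdeal.coeToSubmodule_injective
  beta_reduce
  rw [FractionalIdeal.coe_mul, FractionalIdeal.coe_div hJ0, FractionalIdeal.coe_pow]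
  refine le_antisymm (Submodule.le_div_iff_mul_le.1 le_rfl) ?_
  rw [mul_comm]
  have := hm m le_rfl
  rwa [hspan] at this

end Chart

/-! ### From divisors of powers of `I` to projective differentials -/

section Local

variable {k : Type v} {R K : Type u} [Field k] [CommRing R] [Algebra k R]
    [Field K] [Algebra R K] [Algebra k K] [IsScalarTower k R K]

/-- Membership in an `A`-submodule of `K` is a local question on `Spec A`. -/
theorem Subalgebra.mem_of_forall_isMaximal_exists {A : Subalgebra R K} {P : Submodule R K}
    (hP : Subalgebra.toSubmodule A * P ≤ P) {x : K}
    (h : ∀ p : Ideal A, p.IsMaximal → ∃ g : A, g ∉ p ∧ ∃ n : ℕ, x * (g : K) ^ n ∈ P) : x ∈ P := by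
  let Q : Ideal A :=
    { carrier := {a | x * (a : K) ∈ P}
      zero_mem' := by simp
      add_mem' := fun {a b} ha hb => by
        change x * ((a : K) + b) ∈ P
        rw [mul_add]
        exact add_mem ha hb
      smul_mem' := fun c a ha => by
        change x * ((c : K) * a) ∈ P
        rw [mul_left_comm]
        exact hP (Submodule.mul_mem_mul c.2 ha) }
  have hQ : Q = ⊤ := by
    by_contra hne
    obtain ⟨p, hp, hle⟩ := Ideal.exists_le_maximal Q hne
    obtain ⟨g, hg, n, hn⟩ := h p hp
    have : g ^ n ∈ Q := by
      change x * ((g ^ n : A) : K) ∈ P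
      simpa using hn
    exact hg (hp.isPrime.mem_of_pow_mem n (hle this))
  have h1 : (1 : A) ∈ Q := hQ ▸ Submodule.mem_top
  simpa [Q] using h1

/-- If the differentials of `T'` span those of `C`, every minor on elements of `C` is a `C`-linear
combination of minors on elements of `T'`. -/
theorem toSubmodule_mul_span_derivationMinors_le {L : SingularFoliation k K} {r : ℕ}
    (δ : Module.Basis (Fin r) K L.toSubmodule) {C : Subalgebra R K} {T T' : Set K} (hT : T ⊆ C)
    (hC : C.restrictScalars k ≤ L.differentialSpan (C.restrictScalars k) T') :
    Subalgebra.toSubmodule C *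
        Submodule.span R (derivationMinors (fun l => (δ l : Derivation k K K)) T) ≤
      Subalgebra.toSubmodule C *
        Submodule.span R (derivationMinors (fun l => (δ l : Derivation k K K)) T') := by
  refine Submodule.mul_le.2 fun c hc x hx => ?_
  rw [← C.isIdempotentElem_toSubmodule.eq, mul_assoc]
  refine Submodule.mul_mem_mul hc ?_
  induction hx using Submodule.span_induction with
  | mem x hx =>
    obtain ⟨t, ht, rfl⟩ := hx
    refine mem_toSubmodule_mul_span (k := k) ?_
    rw [← dualBasis_det_differential]
    exact dualBasis_det_mem_span δ fun j => (hC (hT (ht j))).2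
  | zero => exact zero_mem _
  | add x y _ _ hx hy => exact add_mem hx hy
  | smul a x _ hx => exact Submodule.smul_mem _ a hx

/-- The quotient `(A : P)` by a finitely generated `P` commutes with localization. -/
theorem IsAwaySubalgebra.mem_toSubmodule_mul_div {A C : Subalgebra R K} {g : K}
    (h : IsAwaySubalgebra A C g) {P : Submodule R K} (hP : P.FG) {x : K}
    (hx : ∀ y ∈ P, x * y ∈ C) :
    x ∈ Subalgebra.toSubmodule C * (Subalgebra.toSubmodule A / P) := by
  classical
  obtain ⟨s, rfl⟩ := hP
  have hs : ∀ y ∈ s, ∃ n : ℕ, ∀ m ≥ n, x * y * g ^ m ∈ A := by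
    intro y hy
    obtain ⟨n, hn⟩ := h.exists_mul_pow_mem _ (hx y (Submodule.subset_span hy))
    refine ⟨n, fun m hm => ?_⟩
    obtain ⟨l, rfl⟩ := Nat.exists_eq_add_of_le hm
    rw [pow_add, ← mul_assoc]
    exact mul_mem hn (pow_mem h.mem l)
  choose! n hn using hs
  have hx' : x = g⁻¹ ^ s.sup n * (x * g ^ s.sup n) := by
    rw [mul_left_comm, inv_pow, inv_mul_cancel₀ (pow_ne_zero _ h.ne_zero), mul_one]
  rw [hx']
  refine Submodule.mul_mem_mul (pow_mem h.inv_mem _) ?_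
  rw [Submodule.mem_div_iff_forall_mul_mem]
  intro y hy
  induction hy using Submodule.span_induction with
  | mem y hy =>
    rw [mul_right_comm]
    exact hn y hy _ (Finset.le_sup hy)
  | zero => simp
  | add y z _ _ hy hz =>
    rw [mul_add]
    exact add_mem hy hz
  | smul a y _ hy =>
    rw [mul_smul_comm]
    exact Submodule.smul_mem _ a hy

variable [IsDomain R] [Algebra.FiniteType k R] [IsFractionRing R K] {L : SingularFoliation k K}
  {r : ℕ} (δ : Module.Basis (Fin r) K L.toSubmodule) {I : Ideal R}

/-- Suppose `S 𝒥(I) = I ^ α`, and let `C` be a common localization of `A` and of a chart of the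
blowup. Then `Δ * (I ^ (r + 1) * S * (A : I ^ α))`, with `Δ` spanned by the minors on
elements of `A`, generates the unit ideal of `C`: over `C` one has `I = f C` and
`Δ I ^ (r + 1) = Δ f ^ (r + 1) = 𝒥(I)`, and `(A : I ^ α)` becomes inverse to `I ^ α`. -/
theorem toSubmodule_mul_eq_of_isAwaySubalgebra {S : Submodule R K} {α : ℕ}
    (hS : S * (jacobianIdeal (fun l => (δ l : Derivation k K K)) (I : FractionalIdeal R⁰ K) :
      Submodule R K) = ((I : FractionalIdeal R⁰ K) : Submodule R K) ^ α)
    {A C : Subalgebra R K} {f : R} {g h : K} (hf : f ∈ I) (hf0 : f ≠ 0)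
    (hA : IsAwaySubalgebra A C g) (hB : IsAwaySubalgebra (chartAlgebra K I f) C h) :
    Subalgebra.toSubmodule C *
      (Submodule.span R (derivationMinors (fun l => (δ l : Derivation k K K)) A) *
        (((I : FractionalIdeal R⁰ K) : Submodule R K) ^ (r + 1) * S *
          (Subalgebra.toSubmodule A / ((I : FractionalIdeal R⁰ K) : Submodule R K) ^ α))) =
      Subalgebra.toSubmodule C := by
  have : IsNoetherianRing R := Algebra.FiniteType.isNoetherianRing k R
  have hf0' : algebraMap R K f ≠ 0 := by simpa using hf0
  have hTC : chartGenerators K I f ⊆ C := fun x hx => hB.le (Algebra.subset_adjoin hx)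
  have hJ := toSubmodule_mul_jacobianIdeal (fun l => (δ l : Derivation k K K)) hTC hf hf0'
  have hpow := toSubmodule_mul_coeIdeal_pow hTC hf hf0'
  have hΔ : Subalgebra.toSubmodule C *
      Submodule.span R (derivationMinors (fun l => (δ l : Derivation k K K)) A) =
      Subalgebra.toSubmodule C * Submodule.span R
        (derivationMinors (fun l => (δ l : Derivation k K K)) (chartGenerators K I f)) :=
    le_antisymm
      (toSubmodule_mul_span_derivationMinors_le δ (fun x hx => hA.le hx)
        (hB.le_differentialSpan (chartAlgebra_le_differentialSpan L hf hB.le)))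
      (toSubmodule_mul_span_derivationMinors_le δ hTC
        (hA.le_differentialSpan fun x hx =>
          SingularFoliation.subset_differentialSpan (fun y hy => hA.le hy) hx))
  set Δ := Submodule.span R (derivationMinors (fun l => (δ l : Derivation k K K)) A)
  set Δ' := Submodule.span R
        (derivationMinors (fun l => (δ l : Derivation k K K)) (chartGenerators K I f))
  set P := ((I : FractionalIdeal R⁰ K) : Submodule R K)
  set J := ((jacobianIdeal (fun l => (δ l : Derivation k K K)) (I : FractionalIdeal R⁰ K) :
    FractionalIdeal R⁰ K) : Submodule R K)
  set D := Subalgebra.toSubmodule A / P ^ α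
  set 𝒞 := Subalgebra.toSubmodule C
  calc 𝒞 * (Δ * (P ^ (r + 1) * S * D)) = (𝒞 * Δ) * P ^ (r + 1) * (S * D) := by ring
    _ = (𝒞 * P ^ (r + 1)) * Δ' * (S * D) := by rw [hΔ]; ring
    _ = (𝒞 * Δ' * Submodule.span R {algebraMap R K f ^ (r + 1)}) * (S * D) := by
      rw [hpow]; ring
    _ = 𝒞 * (S * J) * D := by rw [hJ]; ring
    _ = 𝒞 * (P ^ α * D) := by rw [hS]; ring
    _ = 𝒞 := by
      have hPfg : (P ^ α).FG := by
        rw [← FractionalIdeal.coe_pow]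
        exact isNoetherian_submodule.1 (FractionalIdeal.isNoetherian _) _ le_rfl
      refine le_antisymm ?_ ?_
      · refine (mul_le_mul_right (?_ : P ^ α * D ≤ 𝒞) 𝒞).trans
          C.isIdempotentElem_toSubmodule.eq.le
        rw [mul_comm]
        exact (Submodule.le_div_iff_mul_le.1 le_rfl).trans hA.le
      · have hinv : (algebraMap R K f ^ α)⁻¹ ∈ 𝒞 * D := by
          refine hA.mem_toSubmodule_mul_div hPfg fun y hy => ?_
          have hy' : y ∈ 𝒞 * P ^ α := by
            rw [← one_mul y]
            exact Submodule.mul_mem_mul (one_mem C) hy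
          rw [hpow] at hy'
          obtain ⟨c, hc, rfl⟩ := Submodule.mem_mul_span_singleton.1 hy'
          rwa [mul_comm, mul_inv_cancel_right₀ (pow_ne_zero α hf0')]
        intro c hc
        have hfα : algebraMap R K f ^ α ∈ P ^ α :=
          Submodule.pow_mem_pow _ (FractionalIdeal.mem_coeIdeal_of_mem _ hf) α
        have h1 : algebraMap R K f ^ α * (algebraMap R K f ^ α)⁻¹ ∈ P ^ α * (𝒞 * D) :=
          Submodule.mul_mem_mul hfα hinv
        rw [mul_inv_cancel₀ (pow_ne_zero α hf0')] at h1
        have h2 := Submodule.mul_mem_mul hc h1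
        have h3 : 𝒞 * (P ^ α * (𝒞 * D)) = 𝒞 * 𝒞 * (P ^ α * D) := by ring
        rwa [mul_one, h3, C.isIdempotentElem_toSubmodule.eq] at h2

/-- Suppose `S 𝒥(I) = I ^ α`, and let `A` be locally, on its spectrum, a localization of the charts
of the blowup. Then the reduced differentials of `A` are projective: the inverse
`I ^ (r + 1) * S * (A : I ^ α)` of the determinant module of `A` is defined globally, and that it
is an inverse can be checked locally. -/
theorem projective_of_forall_isMaximal_exists {S : FractionalIdeal R⁰ K} {α : ℕ}
    (hS : S * jacobianIdeal (fun l => (δ l : Derivation k K K)) (I : FractionalIdeal R⁰ K) =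
      (I : FractionalIdeal R⁰ K) ^ α) (A : Subalgebra R K)
    (hA : ∀ p : Ideal A, p.IsMaximal → ∃ g : A, g ∉ p ∧ ∃ f ∈ I, f ≠ 0 ∧
      ∃ (C : Subalgebra R K) (h : K), IsAwaySubalgebra A C g ∧
        IsAwaySubalgebra (chartAlgebra K I f) C h) :
    Module.Projective (A.restrictScalars k)
      (L.reducedDifferentials (A.restrictScalars k)) := by
  have hS' := congrArg (fun J : FractionalIdeal R⁰ K => (J : Submodule R K)) hS
  simp only [FractionalIdeal.coe_mul, FractionalIdeal.coe_pow] at hS'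
  set N := ((I : FractionalIdeal R⁰ K) : Submodule R K) ^ (r + 1) * (S : Submodule R K) *
    (Subalgebra.toSubmodule A / ((I : FractionalIdeal R⁰ K) : Submodule R K) ^ α) with hN
  set Δ := Submodule.span R (derivationMinors (fun l => (δ l : Derivation k K K)) A) with hΔ
  have hloc : ∀ p : Ideal A, p.IsMaximal → ∃ g : A, g ∉ p ∧ ∃ C : Subalgebra R K,
      IsAwaySubalgebra A C g ∧
        Subalgebra.toSubmodule C * (Δ * N) = Subalgebra.toSubmodule C := by
    intro p hp
    obtain ⟨g, hg, f, hf, hf0, C, h, hAC, hBC⟩ := hA p hp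
    exact ⟨g, hg, C, hAC, toSubmodule_mul_eq_of_isAwaySubalgebra δ hS' hf hf0 hAC hBC⟩
  have hle : Δ * N ≤ Subalgebra.toSubmodule A := by
    intro x hx
    refine Subalgebra.mem_of_forall_isMaximal_exists A.isIdempotentElem_toSubmodule.eq.le
      fun p hp => ?_
    obtain ⟨g, hg, C, hAC, hC⟩ := hloc p hp
    have hx' : x ∈ Subalgebra.toSubmodule C := by
      rw [← hC, ← one_mul x]
      exact Submodule.mul_mem_mul (one_mem C) hx
    exact ⟨g, hg, hAC.exists_mul_pow_mem x hx'⟩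
  have hone : (1 : K) ∈ Subalgebra.toSubmodule A * (Δ * N) := by
    refine Subalgebra.mem_of_forall_isMaximal_exists (A := A) ?_ fun p hp => ?_
    · rw [← mul_assoc, A.isIdempotentElem_toSubmodule.eq]
    obtain ⟨g, hg, C, hAC, hC⟩ := hloc p hp
    exact ⟨g, hg, hAC.exists_mul_pow_mem_mul (by rw [hC]; exact one_mem C)⟩
  refine projective_reducedDifferentials δ (C := A.restrictScalars k) (T := A) (fun x hx => hx)
    (fun x hx => SingularFoliation.subset_differentialSpan (fun y hy => hy) hx) ?_
  have hc : ∀ n ∈ Subalgebra.toSubmodule A * N, ∀ x ∈ Submodule.span (A.restrictScalars k)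
      (derivationMinors (fun l => (δ l : Derivation k K K)) A), n * x ∈ A := by
    intro n hn x hx
    have h1 := Submodule.mul_mem_mul hn (mem_toSubmodule_mul_span hx)
    have h2 : Subalgebra.toSubmodule A * N * (Subalgebra.toSubmodule A * Δ) =
        Subalgebra.toSubmodule A * Subalgebra.toSubmodule A * (Δ * N) := by ring
    rw [← hΔ, h2, A.isIdempotentElem_toSubmodule.eq] at h1
    have h3 := mul_le_mul_right hle (Subalgebra.toSubmodule A) h1
    rwa [A.isIdempotentElem_toSubmodule.eq] at h3
  rw [mul_left_comm] at hone
  generalize (1 : K) = x at hone ⊢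
  induction hone using Submodule.mul_induction_on' with
  | mem_mul_mem x hx n hn =>
    induction hx using Submodule.span_induction generalizing n with
    | mem x hx =>
      exact AddSubmonoid.subset_closure ⟨n, hc n hn, x, hx, mul_comm _ _⟩
    | zero => rw [zero_mul]; exact zero_mem _
    | add x y _ _ hx hy =>
      rw [add_mul]
      exact add_mem (hx n hn) (hy n hn)
    | smul a x _ hx =>
      rw [smul_mul_assoc, ← mul_smul_comm]
      exact hx _ (Submodule.smul_mem _ a hn)
  | add x _ y _ hx hy => exact add_mem hx hy

end Local

/-! ### Sections of the blowup as elements of the function field -/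

section Evaluation

variable {R K : Type u} [CommRing R] [Field K] [Algebra R K] {X : Scheme.{u}}
  (ι : Spec (.of K) ⟶ X)

theorem top_le_of_nonempty_opens_Spec {W : (Spec (.of K)).Opens}
    (h : (W : Set (Spec (.of K))).Nonempty) :
    ⊤ ≤ W := by
  intro y _
  obtain ⟨x, hx⟩ := h
  have : Subsingleton (PrimeSpectrum K) := inferInstance
  have hxy : x = y := this.elim (α := PrimeSpectrum K) x y
  exact hxy ▸ hx

/-- The value in `K` at a `K`-valued point `ι` of a section over an open set `U` containing the
image of `ι`. The condition on `U` is stated as `⊤ ≤ ι ⁻¹ᵁ U`. -/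
noncomputable def evalAt (U : X.Opens) (hU : ⊤ ≤ ι ⁻¹ᵁ U) : Γ(X, U) →+* K :=
  (ι.appLE U ⊤ hU ≫ (Scheme.ΓSpecIso (.of K)).hom).hom

variable {ι}

theorem evalAt_map {U V : X.Opens} (hU : ⊤ ≤ ι ⁻¹ᵁ U) (hV : ⊤ ≤ ι ⁻¹ᵁ V) (i : U ⟶ V)
    (y : Γ(X, V)) : evalAt ι U hU (X.presheaf.map i.op y) = evalAt ι V hV y := by
  have := ConcreteCategory.congr_hom (ι.map_appLE hU i.op) y
  exact congrArg (Scheme.ΓSpecIso (.of K)).hom this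

theorem mem_sectionSubalgebra_iff {π : X ⟶ Spec (.of R)}
    (h : ι ≫ π = Spec.map (CommRingCat.ofHom (algebraMap R K))) {U : X.Opens}
    (hU : ⊤ ≤ ι ⁻¹ᵁ U) {x : K} :
    x ∈ sectionSubalgebra π ι h U ↔ ∃ y, evalAt ι U hU y = x := by
  have h1 : (Spec (.of K)).presheaf.map (homOfLE (le_top : ι ⁻¹ᵁ U ≤ ⊤)).op ≫
      (Spec (.of K)).presheaf.map (homOfLE hU).op = 𝟙 _ := by
    rw [← Functor.map_comp, ← (Spec (.of K)).presheaf.map_id]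
    rfl
  have h2 : (Spec (.of K)).presheaf.map (homOfLE hU).op ≫
      (Spec (.of K)).presheaf.map (homOfLE (le_top : ι ⁻¹ᵁ U ≤ ⊤)).op = 𝟙 _ := by
    rw [← Functor.map_comp, ← (Spec (.of K)).presheaf.map_id]
    rfl
  have hiff : ∀ y : Γ(X, U), ι.app U y = (Spec (.of K)).presheaf.map
      (homOfLE (le_top : ι ⁻¹ᵁ U ≤ ⊤)).op ((Scheme.ΓSpecIso (.of K)).inv x) ↔
      evalAt ι U hU y = x := by
    intro y
    change _ ↔ (Scheme.ΓSpecIso (.of K)).hom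
      ((Spec (.of K)).presheaf.map (homOfLE hU).op (ι.app U y)) = x
    constructor
    · intro hy
      rw [hy]
      have := ConcreteCategory.congr_hom h1 ((Scheme.ΓSpecIso (.of K)).inv x)
      simp only [CommRingCat.comp_apply, CommRingCat.id_apply] at this
      rw [this]
      exact ConcreteCategory.congr_hom (Scheme.ΓSpecIso (.of K)).inv_hom_id x
    · rintro rfl
      have h3 := ConcreteCategory.congr_hom (Scheme.ΓSpecIso (.of K)).hom_inv_id
        ((Spec (.of K)).presheaf.map (homOfLE hU).op (ι.app U y))
      simp only [CommRingCat.comp_apply, CommRingCat.id_apply] at h3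
      rw [h3]
      exact (ConcreteCategory.congr_hom h2 (ι.app U y)).symm
  exact exists_congr hiff

theorem top_le_preimage_basicOpen {U : X.Opens} (hU : ⊤ ≤ ι ⁻¹ᵁ U) {g : Γ(X, U)}
    (hg : evalAt ι U hU g ≠ 0) : ⊤ ≤ ι ⁻¹ᵁ X.basicOpen g := by
  have h1 : IsUnit (ι.appLE U ⊤ hU g) := by
    have := (hg.isUnit).map (Scheme.ΓSpecIso (.of K)).inv.hom
    have h3 := ConcreteCategory.congr_hom (Scheme.ΓSpecIso (.of K)).hom_inv_id (ι.appLE U ⊤ hU g)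
    exact h3 ▸ this
  have h2 := Scheme.basicOpen_of_isUnit _ h1
  rw [Scheme.basicOpen_appLE, top_inf_eq] at h2
  exact h2.ge

/-- Restriction to a basic open set of an affine open set localizes the algebra of sections. -/
theorem isAwaySubalgebra_basicOpen {π : X ⟶ Spec (.of R)}
    (h : ι ≫ π = Spec.map (CommRingCat.ofHom (algebraMap R K))) {U : X.Opens}
    (hUa : IsAffineOpen U) (hU : ⊤ ≤ ι ⁻¹ᵁ U) (g : Γ(X, U)) (hg : ⊤ ≤ ι ⁻¹ᵁ X.basicOpen g) :
    IsAwaySubalgebra (sectionSubalgebra π ι h U) (sectionSubalgebra π ι h (X.basicOpen g))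
      (evalAt ι U hU g) := by
  have hloc := hUa.isLocalization_basicOpen g
  have halg : ∀ y : Γ(X, U), evalAt ι _ hg (algebraMap Γ(X, U) Γ(X, X.basicOpen g) y) =
      evalAt ι U hU y := fun y => evalAt_map hg hU (homOfLE (X.basicOpen_le g)) y
  have hunit : IsUnit (algebraMap Γ(X, U) Γ(X, X.basicOpen g) g) :=
    IsLocalization.Away.algebraMap_isUnit g
  refine ⟨fun x hx => ?_, ?_, ?_, ?_, fun x hx => ?_⟩
  · rw [mem_sectionSubalgebra_iff h hU] at hx
    rw [mem_sectionSubalgebra_iff h hg]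
    obtain ⟨y, rfl⟩ := hx
    exact ⟨_, halg y⟩
  · rw [mem_sectionSubalgebra_iff h hU]
    exact ⟨g, rfl⟩
  · rw [← halg]
    exact (hunit.map (evalAt ι _ hg)).ne_zero
  · rw [mem_sectionSubalgebra_iff h hg]
    obtain ⟨w, hw⟩ := hunit.exists_right_inv
    refine ⟨w, (inv_eq_of_mul_eq_one_right ?_).symm⟩
    rw [← halg, ← map_mul, hw, map_one]
  · rw [mem_sectionSubalgebra_iff h hg] at hx
    obtain ⟨y, rfl⟩ := hx
    obtain ⟨n, a, ha⟩ := IsLocalization.Away.surj g y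
    refine ⟨n, ?_⟩
    rw [mem_sectionSubalgebra_iff h hU]
    refine ⟨a, ?_⟩
    rw [← halg, ← halg, ← ha, map_mul, map_pow]

/-- If a `K`-valued point factors through an open immersion `Spec S ⟶ X` by a homomorphism
`ψ : S ⟶ K`, then evaluation on the image of that immersion is `ψ`, up to the identification of the
sections with `S`. -/
theorem exists_ringEquiv_evalAt_eq {S : CommRingCat.{u}} (j : Spec S ⟶ X) [IsOpenImmersion j]
    (ψ : S ⟶ .of K) (hι : Spec.map ψ ≫ j = ι) {V : X.Opens} (hV : V = j.opensRange)
    (hιV : ⊤ ≤ ι ⁻¹ᵁ V) : ∃ e : Γ(X, V) ≃+* S, ∀ y, evalAt ι V hιV y = ψ (e y) := by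
  subst hV hι
  have he : ⊤ ≤ j ⁻¹ᵁ j.opensRange := fun x _ => ⟨x, rfl⟩
  have hiso : IsIso (j.appLE j.opensRange ⊤ he) := by
    have (V : X.Opens) (hV : j ''ᵁ ⊤ = V) (e : ⊤ ≤ j ⁻¹ᵁ V) : IsIso (j.appLE V ⊤ e) := by
      subst hV
      rw [← Scheme.Hom.appIso_hom']
      infer_instance
    exact this _ (Scheme.Hom.image_top_eq_opensRange j) he
  refine ⟨(asIso (j.appLE j.opensRange ⊤ he) ≪≫ Scheme.ΓSpecIso S).commRingCatIsoToRingEquiv,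
    fun y => ?_⟩
  have h1 : (Spec.map ψ ≫ j).appLE j.opensRange ⊤ hιV ≫ (Scheme.ΓSpecIso (.of K)).hom =
      j.appLE j.opensRange ⊤ he ≫ (Scheme.ΓSpecIso S).hom ≫ ψ := by
    rw [← Scheme.ΓSpecIso_naturality, ← Scheme.Hom.appLE_comp_appLE _ _ _ ⊤ _ he le_top,
      Category.assoc]
    congr 2
  exact ConcreteCategory.congr_hom h1 y

end Evaluation

section Blowup

variable {R : Type u} [CommRing R] {I : Ideal R}

/-- The element `a tⁿ` of the Rees algebra, for `a ∈ Iⁿ`. -/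
noncomputable def reesMonomial {n : ℕ} (a : R) (ha : a ∈ I ^ n) : reesAlgebra I :=
  ⟨Polynomial.monomial n a, reesAlgebra.monomial_mem.mpr ha⟩

theorem reesMonomial_mem {n : ℕ} (a : R) (ha : a ∈ I ^ n) :
    reesMonomial a ha ∈ reesGrading I n := ⟨a, rfl⟩

theorem exists_eq_reesMonomial {n : ℕ} {p : reesAlgebra I} (hp : p ∈ reesGrading I n) :
    ∃ (a : R) (ha : a ∈ I ^ n), p = reesMonomial a ha := by
  obtain ⟨a, h⟩ := hp
  exact ⟨a, reesAlgebra.monomial_mem.1 (h ▸ p.2), Subtype.ext h.symm⟩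

/-- The element `f t` of the Rees algebra, for `f ∈ I`. -/
noncomputable def reesGenerator (f : I) : reesAlgebra I :=
  reesMonomial (n := 1) (f : R) (by simp)

theorem reesGenerator_mem (f : I) : reesGenerator f ∈ reesGrading I 1 := reesMonomial_mem _ _

theorem reesMonomial_mem_span {n : ℕ} (hn : 0 < n) (a : R) (ha : a ∈ I ^ n) :
    reesMonomial a ha ∈ Ideal.span (Set.range (reesGenerator (I := I))) := by
  obtain ⟨n, rfl⟩ := Nat.exists_eq_succ_of_ne_zero hn.ne'
  have ha' := ha
  rw [Nat.succ_eq_add_one, pow_succ] at ha'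
  induction ha' using Submodule.mul_induction_on' with
  | mem_mul_mem b hb c hc =>
    have : reesMonomial (b * c) ha = reesMonomial b hb * reesGenerator ⟨c, hc⟩ :=
      Subtype.ext (Polynomial.monomial_mul_monomial n 1 b c).symm
    rw [this]
    exact Ideal.mul_mem_left _ _ (Ideal.subset_span ⟨_, rfl⟩)
  | add b hb c hc hb' hc' =>
    rw [← pow_succ] at hb hc
    have : reesMonomial (b + c) ha = reesMonomial b hb + reesMonomial c hc :=
      Subtype.ext (map_add (Polynomial.monomial (n + 1)) b c)
    rw [this]
    exact add_mem (hb' hb) (hc' hc)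

/-- The charts `D₊(f t)` with `0 ≠ f ∈ I` cover the blowup, since the elements `f t` generate
the irrelevant ideal. -/
theorem exists_mem_basicOpen_reesGenerator (x : blowup I) :
    ∃ f : I, (f : R) ≠ 0 ∧ x ∈ Proj.basicOpen (reesGrading I) (reesGenerator f) := by
  classical
  have htop := Proj.iSup_basicOpen_eq_top (reesGrading I) (reesGenerator (I := I)) (by
    intro z hz
    rw [← DirectSum.sum_support_decompose (reesGrading I) z]
    refine Ideal.sum_mem _ fun c hc => ?_
    rcases Nat.eq_zero_or_pos c with rfl | hc0
    · have h0 : ((DirectSum.decompose (reesGrading I) z 0 : reesGrading I 0) : reesAlgebra I) = 0 :=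
        hz
      rw [h0]
      exact zero_mem _
    · obtain ⟨a, ha, h⟩ := exists_eq_reesMonomial (DirectSum.decompose (reesGrading I) z c).2
      rw [h]
      exact reesMonomial_mem_span hc0 a ha)
  have hx : x ∈ ⨆ i, Proj.basicOpen (reesGrading I) (reesGenerator i) := htop ▸ trivial
  obtain ⟨f, hf⟩ := TopologicalSpace.Opens.mem_iSup.1 hx
  refine ⟨f, fun h0 => hf ?_, hf⟩
  have : reesGenerator f = 0 := Subtype.ext (by
    change Polynomial.monomial 1 (f : R) = 0
    rw [h0, map_zero])
  rw [this]
  exact zero_mem _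

variable {K : Type u} [Field K] [Algebra R K]

/-- A homomorphism over `R` from the ring of the chart `D₊(f t)` to `K` sends `a tⁿ / (f t)ⁿ` to
`a / fⁿ`. -/
theorem ringHom_awayMk_mul_pow {f : I}
    {ψ : HomogeneousLocalization.Away (reesGrading I) (reesGenerator f) →+* K}
    (hψ : ∀ a : R, ψ (HomogeneousLocalization.fromZeroRingHom (reesGrading I) _
      (algebraMap R (reesGrading I 0) a)) = algebraMap R K a)
    (n : ℕ) {a : R} (ha : a ∈ I ^ (n • 1)) :
    ψ (HomogeneousLocalization.Away.mk (reesGrading I) (reesGenerator_mem f) n (reesMonomial a ha)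
      (reesMonomial_mem a ha)) * algebraMap R K f ^ n = algebraMap R K a := by
  rw [← map_pow, ← hψ, ← hψ, ← map_mul]
  congr 1
  apply HomogeneousLocalization.val_injective
  rw [HomogeneousLocalization.val_mul, HomogeneousLocalization.Away.val_mk]
  change Localization.mk _ _ * Localization.mk (algebraMap R (reesAlgebra I) (f ^ n)) _ =
    Localization.mk (algebraMap R (reesAlgebra I) a) _
  rw [Localization.mk_mul, Localization.mk_eq_mk_iff, Localization.r_iff_exists]
  refine ⟨1, Subtype.ext ?_⟩
  change 1 * (1 * (Polynomial.monomial (n • 1) a * Polynomial.C ((f : R) ^ n))) =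
    1 * (Polynomial.monomial 1 (f : R) ^ n * 1 * Polynomial.C a)
  rw [Polynomial.monomial_pow, Polynomial.monomial_mul_C]
  simp [mul_comm]

variable {ι : Spec (.of K) ⟶ blowup I}
  (hι : ι ≫ blowupMap I = Spec.map (CommRingCat.ofHom (algebraMap R K)))

include hι in
/-- A `K`-valued point of the chart `D₊(f t)` over the generic point of `Spec R` is given by a
homomorphism over `R` from the ring of the chart. -/
theorem exists_ringHom_of_top_le {f : I}
    (hf : ⊤ ≤ ι ⁻¹ᵁ Proj.basicOpen (reesGrading I) (reesGenerator f)) :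
    ∃ ψ : HomogeneousLocalization.Away (reesGrading I) (reesGenerator f) →+* K,
      Spec.map (CommRingCat.ofHom ψ) ≫
        Proj.awayι (reesGrading I) _ (reesGenerator_mem f) one_pos = ι ∧
      ∀ a : R, ψ (HomogeneousLocalization.fromZeroRingHom (reesGrading I) _
        (algebraMap R (reesGrading I 0) a)) = algebraMap R K a := by
  let j := Proj.awayι (reesGrading I) _ (reesGenerator_mem f) one_pos
  have hrange : Set.range ι ⊆ Set.range j := by
    rintro _ ⟨x, rfl⟩
    have := hf (show x ∈ ⊤ from trivial)
    rw [← Proj.opensRange_awayι (reesGrading I) _ (reesGenerator_mem f) one_pos] at this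
    exact this
  obtain ⟨ψ, hψ⟩ := Spec.map_surjective (IsOpenImmersion.lift j ι hrange)
  have hψι : Spec.map ψ ≫ j = ι := by rw [hψ, IsOpenImmersion.lift_fac]
  refine ⟨ψ.hom, hψι, fun a => ?_⟩
  have h1 := hι
  rw [← hψι, blowupMap, Category.assoc, Proj.awayι_toSpecZero_assoc, ← Spec.map_comp,
    ← Spec.map_comp] at h1
  exact ConcreteCategory.congr_hom (Spec.map_injective h1) a

include hι in
/-- A `K`-valued point of the blowup over the generic point of `Spec R` lies in all charts
`D₊(f t)` with `f ≠ 0`: it lies in some `D₊(g t)`, and there `f t / g t` has the nonzero value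
`f / g`. -/
theorem top_le_preimage_basicOpen_reesGenerator [FaithfulSMul R K] {f : I} (hf : (f : R) ≠ 0) :
    ⊤ ≤ ι ⁻¹ᵁ Proj.basicOpen (reesGrading I) (reesGenerator f) := by
  obtain ⟨g, hg0, hg⟩ := exists_mem_basicOpen_reesGenerator (ι (default : PrimeSpectrum K))
  have hg' : ⊤ ≤ ι ⁻¹ᵁ Proj.basicOpen (reesGrading I) (reesGenerator g) :=
    top_le_of_nonempty_opens_Spec ⟨_, hg⟩
  obtain ⟨ψ, rfl, hψ⟩ := exists_ringHom_of_top_le hι hg'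
  intro x _
  change Spec.map (CommRingCat.ofHom ψ) x ∈ Proj.awayι (reesGrading I) _ (reesGenerator_mem g)
    one_pos ⁻¹ᵁ Proj.basicOpen (reesGrading I) (reesGenerator f)
  rw [Proj.awayι_preimage_basicOpen (reesGrading I) _ one_pos (reesGenerator_mem f) one_pos]
  intro hmem
  have hmem' : ψ (HomogeneousLocalization.Away.isLocalizationElem (reesGenerator_mem g)
    (reesGenerator_mem f)) ∈ (x : PrimeSpectrum K).asIdeal := hmem
  have h0 : ψ (HomogeneousLocalization.Away.isLocalizationElem (reesGenerator_mem g)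
      (reesGenerator_mem f)) = 0 := by
    have : (x : PrimeSpectrum K).asIdeal = ⊥ :=
      (eq_bot_or_eq_top _).resolve_right (x : PrimeSpectrum K).2.ne_top
    rw [this] at hmem'
    exact hmem'
  have h1 := ringHom_awayMk_mul_pow hψ 1 (a := (f : R)) (by simp)
  have h2 : HomogeneousLocalization.Away.mk (reesGrading I) (reesGenerator_mem g) 1
      (reesMonomial (f : R) (by simp)) (reesMonomial_mem _ _) =
      HomogeneousLocalization.Away.isLocalizationElem (reesGenerator_mem g)
      (reesGenerator_mem f) := by
    apply HomogeneousLocalization.val_injective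
    rw [HomogeneousLocalization.Away.val_mk, HomogeneousLocalization.Away.val_mk]
    exact congrArg (fun z => Localization.mk z _) (pow_one (reesGenerator f)).symm
  rw [h2, h0, zero_mul] at h1
  exact hf (by simpa using h1.symm)

include hι in
/-- On the chart `D₊(f t)`, evaluation at the generic point is injective and its image is
`R[I/f]`. -/
theorem evalAt_injective_and_mem_sectionSubalgebra_iff [FaithfulSMul R K] {f : I}
    (hf : (f : R) ≠ 0) :
    Function.Injective (evalAt ι _ (top_le_preimage_basicOpen_reesGenerator hι hf)) ∧
    ∀ x : K, x ∈ sectionSubalgebra (blowupMap I) ι hι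
      (Proj.basicOpen (reesGrading I) (reesGenerator f)) ↔ x ∈ chartAlgebra K I f := by
  have hfK : algebraMap R K f ≠ 0 := by simpa using hf
  have htop := top_le_preimage_basicOpen_reesGenerator hι hf
  obtain ⟨ψ, hψι, hψ⟩ := exists_ringHom_of_top_le hι htop
  obtain ⟨e, he⟩ := exists_ringEquiv_evalAt_eq _ _ hψι
    (Proj.opensRange_awayι (reesGrading I) _ (reesGenerator_mem f) one_pos).symm htop
  refine ⟨?_, fun x => ?_⟩
  · rw [injective_iff_map_eq_zero]
    intro y hy
    rw [he] at hy
    obtain ⟨n, p, hp, hz⟩ :=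
      HomogeneousLocalization.Away.mk_surjective _ (reesGenerator_mem f) (e y)
    obtain ⟨a, ha, rfl⟩ := exists_eq_reesMonomial hp
    have h1 := ringHom_awayMk_mul_pow hψ n ha
    rw [hz] at h1
    have ha0 : a = 0 := by
      have h2 : algebraMap R K a = 0 := by
        rw [← h1]
        exact (congrArg (· * algebraMap R K f ^ n) hy).trans (zero_mul _)
      simpa using h2
    subst ha0
    have : e y = 0 := by
      rw [← hz]
      apply HomogeneousLocalization.val_injective
      have h0 : reesMonomial (0 : R) ha = 0 := Subtype.ext (map_zero _)
      rw [HomogeneousLocalization.Away.val_mk, h0, Localization.mk_zero,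
        HomogeneousLocalization.val_zero]
    simpa using this
  · rw [mem_sectionSubalgebra_iff hι htop]
    constructor
    · rintro ⟨y, rfl⟩
      rw [he]
      obtain ⟨n, p, hp, hz⟩ :=
        HomogeneousLocalization.Away.mk_surjective _ (reesGenerator_mem f) (e y)
      obtain ⟨a, ha, rfl⟩ := exists_eq_reesMonomial hp
      have h1 := ringHom_awayMk_mul_pow hψ n ha
      rw [hz] at h1
      have ha' : a ∈ I ^ n := by simpa using ha
      exact mem_chartAlgebra_of_mul_pow_eq hfK ha' h1
    · intro hx
      obtain ⟨n, a, ha, h⟩ := exists_mul_pow_eq_of_mem_chartAlgebra f.2 hx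
      have ha' : a ∈ I ^ (n • 1) := by simpa using ha
      refine ⟨e.symm (HomogeneousLocalization.Away.mk (reesGrading I) (reesGenerator_mem f) n
        (reesMonomial a ha') (reesMonomial_mem a ha')), ?_⟩
      rw [he, RingEquiv.apply_symm_apply]
      refine mul_right_cancel₀ (pow_ne_zero n hfK) ?_
      rw [h]
      exact ringHom_awayMk_mul_pow hψ n ha'

end Blowup

/-! ### Affine open sets of the blowup -/

section Lift

variable {R K : Type u} [CommRing R] [Field K] [Algebra R K] [FaithfulSMul R K] {I : Ideal R}
  {ι : Spec (.of K) ⟶ blowup I}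
  (hι : ι ≫ blowupMap I = Spec.map (CommRingCat.ofHom (algebraMap R K)))

include hι

theorem sectionSubalgebra_basicOpen_reesGenerator {f : I} (hf : (f : R) ≠ 0) :
    sectionSubalgebra (blowupMap I) ι hι (Proj.basicOpen (reesGrading I) (reesGenerator f)) =
      chartAlgebra K I f :=
  SetLike.ext (evalAt_injective_and_mem_sectionSubalgebra_iff hι hf).2

/-- The point `ι` is generic: it lies in every nonempty open set, because evaluation at `ι` is
injective on the charts. -/
theorem top_le_preimage_of_nonempty {U : (blowup I).Opens} (hU : (U : Set (blowup I)).Nonempty) :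
    ⊤ ≤ ι ⁻¹ᵁ U := by
  obtain ⟨x, hx⟩ := hU
  obtain ⟨f, hf, hxf⟩ := exists_mem_basicOpen_reesGenerator x
  obtain ⟨g, hgU, hxg⟩ := (Proj.isAffineOpen_basicOpen (reesGrading I) _ (reesGenerator_mem f)
    one_pos).exists_basicOpen_le ⟨x, hx⟩ hxf
  have hg : g ≠ 0 := by
    rintro rfl
    rw [Scheme.basicOpen_zero] at hxg
    exact hxg
  have hne : evalAt ι _ (top_le_preimage_basicOpen_reesGenerator hι hf) g ≠ 0 := fun h0 =>
    hg ((evalAt_injective_and_mem_sectionSubalgebra_iff hι hf).1 (h0.trans (map_zero _).symm))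
  exact fun y hy => hgU (top_le_preimage_basicOpen _ hne hy)

/-- Locally on an affine open set of the blowup, the algebra of sections is a localization of that
of a chart. -/
theorem exists_isAwaySubalgebra {U : (blowup I).Opens} (hUa : IsAffineOpen U)
    (hU : (U : Set (blowup I)).Nonempty)
    (p : Ideal (sectionSubalgebra (blowupMap I) ι hι U)) (hp : p.IsPrime) :
    ∃ g : sectionSubalgebra (blowupMap I) ι hι U, g ∉ p ∧ ∃ f ∈ I, f ≠ 0 ∧
      ∃ (C : Subalgebra R K) (h : K),
        IsAwaySubalgebra (sectionSubalgebra (blowupMap I) ι hι U) C g ∧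
        IsAwaySubalgebra (chartAlgebra K I f) C h := by
  have hιU := top_le_preimage_of_nonempty hι hU
  let ev : Γ(blowup I, U) →+* sectionSubalgebra (blowupMap I) ι hι U :=
    (evalAt ι U hιU).codRestrict _ fun y => (mem_sectionSubalgebra_iff hι hιU).2 ⟨y, rfl⟩
  let q : PrimeSpectrum Γ(blowup I, U) := ⟨p.comap ev, Ideal.comap_isPrime ev p⟩
  let x : blowup I := hUa.fromSpec q
  have hxU : x ∈ U := by
    have : x ∈ Set.range hUa.fromSpec := ⟨q, rfl⟩
    rwa [hUa.range_fromSpec] at this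
  obtain ⟨f, hf, hxf⟩ := exists_mem_basicOpen_reesGenerator x
  have hV := Proj.isAffineOpen_basicOpen (reesGrading I) _ (reesGenerator_mem f) one_pos
  obtain ⟨g, h, hgh, hxg⟩ := exists_basicOpen_le_affine_inter hUa hV x ⟨hxU, hxf⟩
  have hgq : g ∉ q.asIdeal := by
    have : q ∈ hUa.fromSpec ⁻¹ᵁ (blowup I).basicOpen g := hxg
    rw [hUa.fromSpec_preimage_basicOpen] at this
    exact this
  have hιg : ⊤ ≤ ι ⁻¹ᵁ (blowup I).basicOpen g := top_le_preimage_of_nonempty hι ⟨x, hxg⟩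
  have hιh : ⊤ ≤ ι ⁻¹ᵁ (blowup I).basicOpen h := hgh ▸ hιg
  have h2 := isAwaySubalgebra_basicOpen hι hV (top_le_preimage_basicOpen_reesGenerator hι hf) h hιh
  rw [sectionSubalgebra_basicOpen_reesGenerator hι hf, ← hgh] at h2
  exact ⟨ev g, hgq, f, f.2, hf, _, _, isAwaySubalgebra_basicOpen hι hUa hιU g hιg, h2⟩

end Lift

theorem corollary7 {k : Type v} {R K : Type u} [Field k] [CommRing R] [IsDomain R] [Algebra k R]
    [Algebra.FiniteType k R] [Field K] [Algebra R K] [IsFractionRing R K] [Algebra k K]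
    [IsScalarTower k R K] (L : SingularFoliation k K) {r : ℕ}
    (δ : Module.Basis (Fin r) K L.toSubmodule) (I : Ideal R) :
    L.LiftsToNonsingular I ↔
      ∃ (S : FractionalIdeal R⁰ K) (α : ℕ),
        S * jacobianIdeal (fun i => (δ i : Derivation k K K)) (I : FractionalIdeal R⁰ K) =
          (I : FractionalIdeal R⁰ K) ^ α := by
  constructor
  · intro hL
    -- for `I = 0` both sides hold: the right one with `S = 0` and `α = 1`
    rcases eq_or_ne I ⊥ with rfl | hI
    · refine ⟨0, 1, ?_⟩
      rw [zero_mul, pow_one, FractionalIdeal.coeIdeal_bot]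
    · obtain ⟨ι, hι⟩ := exists_blowup_genericPoint I K hI
      refine exists_mul_jacobianIdeal_eq_pow δ hI fun f hf hf0 => ?_
      have h1 := hL ι hι _
        (Proj.isAffineOpen_basicOpen (reesGrading I) _ (reesGenerator_mem ⟨f, hf⟩) one_pos)
        ⟨_, top_le_preimage_basicOpen_reesGenerator hι (f := ⟨f, hf⟩) hf0
          (show (default : PrimeSpectrum K) ∈ (⊤ : (Spec (.of K)).Opens) from trivial)⟩
      rwa [sectionSubalgebra_basicOpen_reesGenerator hι (f := ⟨f, hf⟩) hf0] at h1
  · rintro ⟨S, α, hS⟩ ι hι U hUa hU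
    exact projective_of_forall_isMaximal_exists δ hS _ fun p hp =>
      exists_isAwaySubalgebra hι hUa hU p hp.isPrime
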